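/- Let $F$ be a field containing a primitive $5$th root of unity $\rho$ (so $\operatorname{char} F\neq 5$), and let $A$ be a cyclic algebra of degree $5$ over $F$, that is, a central simple $F$-algebra of dimension $25$ of the form $F[a,b : a^5=\alpha,\ b^5=\beta,\ ba=\rho ab]$ with $\alpha,\beta\in F^\times$. An element $x\in A$ is called $5$-central if $x\notin F$, $x^5\in F$ and $x^k\notin F$ for $1\le k\le 4$. Let $\mathcal X$ be the set of invertible $5$-central elements of $A$ (if $A$ is a division algebra, these are all the $5$-central elements). For $x,z\in\mathcal X$ there is a unique decomposition $z=\sum_{i\in\mathbb Z/5\mathbb Z} z_i$ with $z_i x=\rho^i x z_i$ for all $i$; put $$l(x,z)=\{i\in\mathbb Z/5\mathbb Z : z_i\neq 0\},\qquad w(x,z)=\#\, l(x,z).$$ A Rost chain connecting $x$ and $z$ is a finite sequence $x=x_0,x_1,\dots,x_n=z$ of elements of $\mathcal X$ with $w(x_k,x_{k+1})=1$ for all $0\le k<n$; equivalently, for every $k$ there is an integer $d_k$ with $x_kx_{k+1}=\rho^{d_k}x_{k+1}x_k$. Theorem. If $x,z\in\mathcal X$ satisfy $w(x,z)=2$ and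 $0\notin l(z,x)$, then there is a Rost chain connecting $x$ and $z$. -/

import Mathlib

namespace RostChains

/-- `x` is `d`-central in the `F`-algebra `A`: it is noncentral, `x ^ d` is central, and no
`x ^ k` with `1 ≤ k ≤ d - 1` is central. -/
def IsDCentral (F : Type*) {A : Type*} [Field F] [Ring A] [Algebra F A] (d : ℕ) (x : A) : Prop :=
  x ∉ Subalgebra.center F A ∧ x ^ d ∈ Subalgebra.center F A ∧
    ∀ k : ℕ, 1 ≤ k → k < d → x ^ k ∉ Subalgebra.center F A

/-- The vertices of the graph: the invertible `d`-central elements, i.e. those by which one can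
conjugate. In a division algebra every `d`-central element is invertible. -/
def IsVertex (F : Type*) {A : Type*} [Field F] [Ring A] [Algebra F A] (d : ℕ) (x : A) : Prop :=
  IsDCentral F d x ∧ IsUnit x

/-- `A` is a cyclic algebra of degree `p` over `F`, where `ρ` is a primitive `p`-th root of unity
of `F`: a central simple `F`-algebra of degree `p` of the symbol form
`F[a, b : a ^ p = α, b ^ p = β, b a = ρ a b]` with `α, β ∈ Fˣ`. It may be split. -/
def IsCyclicAlgebra {F : Type*} [Field F] (p : ℕ) (ρ : F) (A : Type*) [Ring A] [Algebra F A] :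
    Prop :=
  Algebra.IsCentral F A ∧ IsSimpleRing A ∧ Module.finrank F A = p ^ 2 ∧
    ∃ (α β : F) (a b : A), α ≠ 0 ∧ β ≠ 0 ∧ a ^ p = algebraMap F A α ∧
      b ^ p = algebraMap F A β ∧ b * a = ρ • (a * b) ∧ Algebra.adjoin F {a, b} = ⊤

/-- `c` is the decomposition `z = ∑ i, z_i`, indexed by `ℤ/pℤ`, with `z_i x = ρ ^ i x z_i`. -/
def IsDecomposition {F A : Type*} [Field F] [Ring A] [Algebra F A] (p : ℕ) [NeZero p] (ρ : F)
    (x z : A) (c : ZMod p → A) : Prop :=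
  (∀ i : ZMod p, c i * x = ρ ^ i.val • (x * c i)) ∧ ∑ i : ZMod p, c i = z

/-- The label `l(x, z) = {i ∈ ℤ/pℤ : z_i ≠ 0}`, where `z = ∑ i, z_i` and
`z_i x = ρ ^ i x z_i`. The decomposition is unique for the elements that matter, see
`existsUnique_isDecomposition` below. -/
def label {F A : Type*} [Field F] [Ring A] [Algebra F A] (p : ℕ) [NeZero p] (ρ : F)
    (x z : A) : Set (ZMod p) :=
  {i | ∃ c : ZMod p → A, IsDecomposition p ρ x z c ∧ c i ≠ 0}

/-- The weight `w(x, z)`: the number of elements of the label `l(x, z)`. -/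
noncomputable def weight {F A : Type*} [Field F] [Ring A] [Algebra F A] (p : ℕ) [NeZero p] (ρ : F)
    (x z : A) : ℕ :=
  (label p ρ x z).ncard

/-- `x` and `z` are connected by a Rost chain: a finite chain `x = c 0, c 1, …, c n = z` of
vertices in which every edge `(c k, c (k + 1))` has weight `1`. -/
def RostConnected {F A : Type*} [Field F] [Ring A] [Algebra F A] (p : ℕ) [NeZero p] (ρ : F)
    (x z : A) : Prop :=
  ∃ (n : ℕ) (c : ℕ → A), c 0 = x ∧ c n = z ∧ (∀ k ≤ n, IsVertex F p (c k)) ∧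
    ∀ k < n, weight p ρ (c k) (c (k + 1)) = 1

theorem sum_pow_eq_ite {F : Type*} [Field F] (p : ℕ) {ζ : F} (h : ζ ^ p = 1) [Decidable (ζ = 1)] :
    ∑ j ∈ Finset.range p, ζ ^ j = if ζ = 1 then (p : F) else 0 := by
  split_ifs with h1
  · simp [h1]
  · have := mul_geom_sum ζ p
    rw [h, sub_self] at this
    exact (mul_eq_zero.mp this).resolve_left (sub_ne_zero.mpr h1)

/-- The label is well defined: for a vertex `x`, each `z` has exactly one decomposition. -/
theorem existsUnique_isDecomposition {F A : Type*} [Field F] [Ring A] [Algebra F A] (p : ℕ)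
    [NeZero p] {ρ : F} (hρ : IsPrimitiveRoot ρ p) {x : A} (hx : IsVertex F p x) (z : A) :
    ∃! c : ZMod p → A, IsDecomposition p ρ x z c := by
  classical
  obtain ⟨⟨-, hc, -⟩, u, rfl⟩ := hx
  have hp : (p : F) ≠ 0 := hρ.neZero'.out
  have hu (w : A) : (u : A) ^ p * w * ((u⁻¹ : Aˣ) : A) ^ p = w := by
    rw [← (Subalgebra.mem_center_iff.mp hc w), mul_assoc, ← Units.val_pow_eq_pow_val,
      ← Units.val_pow_eq_pow_val, inv_pow, Units.mul_inv, mul_one]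
  have hρ0 : ρ ≠ 0 := hρ.ne_zero (NeZero.ne p)
  refine ⟨fun i => (p : F)⁻¹ • ∑ j ∈ Finset.range p,
    (ρ ^ i.val) ^ j • ((u : A) ^ j * z * ((u⁻¹ : Aˣ) : A) ^ j), ⟨fun i => ?_, ?_⟩, ?_⟩
  · set t := ρ ^ i.val with ht
    have htp : t ^ p = 1 := by rw [ht, ← pow_mul, mul_comm, pow_mul, hρ.pow_eq_one, one_pow]
    set f : ℕ → A := fun j => t ^ j • ((u : A) ^ j * z * ((u⁻¹ : Aˣ) : A) ^ j) with hf
    have hstep (j : ℕ) : t • ((u : A) * f j) = f (j + 1) * u := by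
      simp only [hf, mul_smul_comm, smul_mul_assoc, smul_smul]
      rw [pow_succ', pow_succ' (u : A), pow_succ ((u⁻¹ : Aˣ) : A)]
      congr 1
      simp [mul_assoc]
    have hfp : f p = f 0 := by simp only [hf, htp, hu]; simp
    have hs : ∑ j ∈ Finset.range p, f (j + 1) = ∑ j ∈ Finset.range p, f j := by
      have h1 := Finset.sum_range_succ f p
      have h2 := Finset.sum_range_succ' f p
      rw [h1, hfp] at h2
      exact (add_right_cancel h2).symm
    simp only [smul_mul_assoc, mul_smul_comm]
    rw [smul_comm t]
    congr 1
    rw [Finset.mul_sum, Finset.smul_sum, Finset.sum_congr rfl fun j _ => hstep j,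
      ← Finset.sum_mul, hs]
  · have key (j : ℕ) (hj : j < p) :
        ∑ i : ZMod p, (ρ ^ i.val) ^ j = if j = 0 then (p : F) else 0 := by
      have h1 : ∑ i : ZMod p, (ρ ^ i.val) ^ j = ∑ i ∈ Finset.range p, (ρ ^ j) ^ i := by
        refine Finset.sum_nbij' (fun i => i.val) (fun i => (i : ZMod p)) ?_ ?_ ?_ ?_ ?_
        · intro i _; simpa using ZMod.val_lt i
        · intro i _; simp
        · intro i _; simp
        · intro i hi; exact ZMod.val_cast_of_lt (by simpa using hi)
        · intro i _; rw [← pow_mul, ← pow_mul, mul_comm]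
      rw [h1, sum_pow_eq_ite p (by rw [← pow_mul, mul_comm, pow_mul, hρ.pow_eq_one, one_pow])]
      refine if_congr ⟨fun h => ?_, fun h => by simp [h]⟩ rfl rfl
      by_contra h0
      exact hρ.pow_ne_one_of_pos_of_lt h0 hj h
    rw [← Finset.smul_sum, Finset.sum_comm]
    simp only [← Finset.sum_smul]
    rw [Finset.sum_congr rfl fun j hj => by rw [key j (by simpa using hj)],
      Finset.sum_eq_single_of_mem 0 (by simpa using NeZero.pos p) (by intro j _ h; simp [h])]
    simp [smul_smul, hp]
  · rintro d ⟨hd, rfl⟩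
    funext i
    have hconj (k : ZMod p) (j : ℕ) :
        (ρ ^ i.val) ^ j • ((u : A) ^ j * d k * ((u⁻¹ : Aˣ) : A) ^ j)
          = (ρ ^ i.val * (ρ ^ k.val)⁻¹) ^ j • d k := by
      have h1 : (u : A) * d k * ((u⁻¹ : Aˣ) : A) = (ρ ^ k.val)⁻¹ • d k := by
        rw [Units.mul_inv_eq_iff_eq_mul, smul_mul_assoc, hd k, smul_smul,
          inv_mul_cancel₀ (pow_ne_zero _ hρ0), one_smul]
      rw [mul_pow, ← smul_smul]
      congr 1
      induction j with
      | zero => simp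
      | succ j ih =>
        rw [pow_succ (u : A), pow_succ' ((u⁻¹ : Aˣ) : A)]
        calc (u : A) ^ j * u * d k * (((u⁻¹ : Aˣ) : A) * ((u⁻¹ : Aˣ) : A) ^ j)
            = (u : A) ^ j * (u * d k * ((u⁻¹ : Aˣ) : A)) * ((u⁻¹ : Aˣ) : A) ^ j := by
              simp only [mul_assoc]
          _ = _ := by rw [h1, mul_smul_comm, smul_mul_assoc, ih, smul_smul, pow_succ']
    simp only [Finset.mul_sum, Finset.sum_mul, Finset.smul_sum, hconj]
    rw [Finset.sum_comm]
    have hsum (k : ZMod p) :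
        ∑ j ∈ Finset.range p, (p : F)⁻¹ • (ρ ^ i.val * (ρ ^ k.val)⁻¹) ^ j • d k
          = if k = i then d k else 0 := by
      rw [← Finset.smul_sum, ← Finset.sum_smul, sum_pow_eq_ite p]
      · have : ρ ^ i.val * (ρ ^ k.val)⁻¹ = 1 ↔ k = i := by
          rw [mul_inv_eq_one₀ (pow_ne_zero _ hρ0)]
          refine ⟨fun h => ?_, fun h => by rw [h]⟩
          exact (ZMod.val_injective p (hρ.pow_inj (ZMod.val_lt i) (ZMod.val_lt k) h)).symm
        simp only [this]
        split_ifs <;> simp [smul_smul, hp]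
      · have hone (k : ZMod p) : (ρ ^ k.val) ^ p = 1 := by
          rw [← pow_mul, mul_comm, pow_mul, hρ.pow_eq_one, one_pow]
        rw [mul_pow, inv_pow, hone, hone, inv_one, one_mul]
    simp [hsum]

end RostChains

/-!
If `A` is split, `A = End V`, every vertex is linked in at most two steps to a dilation of `V` that
fixes a hyperplane, and two such dilations both commute with a third one.

If `A` is a division algebra and `z = y + t` is the decomposition with respect to `x`, it suffices
that `y` and `t` commute up to a root of unity, because `y⁻¹ * t` is then linked to `x` and to `z`.
If one of `y`, `t` commutes with `x`, this follows from `z ^ p ∈ F`. Otherwise, after possibly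
exchanging `y` and `t`, the former commutes with `x` up to a primitive root of unity `ρ` and the
latter up to `ρ ^ 2` or `ρ ^ 4`, and `t` is a sum of five monomials in `x` and `y`, its letters. The
components of `z ^ 5` with respect to `x` that have a nontrivial eigenvalue vanish, and so do all
components of `∑ j, z ^ j * x * z ^ (4 - j)`, since `0 ∉ l(z, x)`. Moving all letters to the left
turns these identities into equations between monomials, whose coefficients are complete
homogeneous symmetric polynomials evaluated at powers of `ρ`. Most of these are zero, being divided
differences of `X ^ 5` at fifth roots of unity, and the remaining ones leave at most one letter.
-/

namespace RostChains

section QCommute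

/-- `a` and `b` commute up to the scalar `q`. The condition `z_i x = ρ ^ i x z_i` on a component
of `z` with respect to `x` reads `QCommute (ρ ^ i) x z_i`. -/
def QCommute {R A : Type*} [CommRing R] [Ring A] [Algebra R A] (q : R) (a b : A) : Prop :=
  b * a = q • (a * b)

namespace QCommute

section CommRing

variable {R A : Type*} [CommRing R] [Ring A] [Algebra R A] {q r : R} {a b c : A}

theorem of_commute (h : Commute a b) : QCommute (1 : R) a b := by
  rw [QCommute, one_smul, h.eq]

theorem commute (h : QCommute (1 : R) a b) : Commute a b := by
  rw [QCommute, one_smul] at h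
  exact h.symm

theorem add_right (hb : QCommute q a b) (hc : QCommute q a c) : QCommute q a (b + c) := by
  rw [QCommute] at *
  rw [add_mul, hb, hc, mul_add, smul_add]

theorem sum_right {ι : Type*} {s : Finset ι} {f : ι → A} (h : ∀ i ∈ s, QCommute q a (f i)) :
    QCommute q a (∑ i ∈ s, f i) := by
  rw [QCommute, Finset.sum_mul, Finset.mul_sum, Finset.smul_sum]
  exact Finset.sum_congr rfl h

theorem smul_right (s : R) (h : QCommute q a b) : QCommute q a (s • b) := by
  rw [QCommute] at *
  rw [smul_mul_assoc, h, mul_smul_comm, smul_comm]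

theorem smul_left (s : R) (h : QCommute q a b) : QCommute q (s • a) b := by
  rw [QCommute] at *
  rw [mul_smul_comm, h, smul_mul_assoc, smul_comm]

theorem mul_right (hb : QCommute q a b) (hc : QCommute r a c) : QCommute (q * r) a (b * c) := by
  rw [QCommute] at *
  rw [mul_assoc, hc, mul_smul_comm, ← mul_assoc, hb, smul_mul_assoc, smul_smul, mul_comm r,
    mul_assoc]

theorem mul_left (ha : QCommute q a c) (hb : QCommute r b c) : QCommute (q * r) (a * b) c := by
  rw [QCommute] at *
  rw [← mul_assoc, ha, smul_mul_assoc, mul_assoc, hb, mul_smul_comm, smul_smul, mul_assoc]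

theorem pow_right (h : QCommute q a b) (n : ℕ) : QCommute (q ^ n) a (b ^ n) := by
  induction n with
  | zero => simpa using of_commute (.one_right a)
  | succ n ih => simpa only [pow_succ] using ih.mul_right h

theorem pow_left (h : QCommute q a b) (n : ℕ) : QCommute (q ^ n) (a ^ n) b := by
  induction n with
  | zero => simpa using of_commute (.one_left b)
  | succ n ih => simpa only [pow_succ] using ih.mul_left h

theorem map {B : Type*} [Ring B] [Algebra R B] (f : A →ₐ[R] B) (h : QCommute q a b) :
    QCommute q (f a) (f b) := by
  rw [QCommute] at *
  rw [← map_mul, h, map_smul, map_mul]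

theorem add_left (ha : QCommute q a c) (hb : QCommute q b c) : QCommute q (a + b) c := by
  rw [QCommute] at *
  rw [mul_add, ha, hb, add_mul, smul_add]

theorem sum_pow_mul_mul_pow (h : QCommute q a b) (n : ℕ) :
    ∑ j ∈ Finset.range n, a ^ j * b * a ^ (n - 1 - j) =
      (∑ j ∈ Finset.range n, q ^ j) • (a ^ (n - 1) * b) := by
  rw [← Finset.sum_range_reflect (fun j => q ^ j), Finset.sum_smul]
  refine Finset.sum_congr rfl fun j hj => ?_
  rw [mul_assoc, h.pow_left, mul_smul_comm, ← mul_assoc, ← pow_add,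
    Nat.add_sub_cancel' (Nat.le_sub_one_of_lt (Finset.mem_range.mp hj))]

end CommRing

section Field

variable {F A : Type*} [Field F] [Ring A] [Algebra F A] {q : F} {a b : A}

theorem symm (hq : q ≠ 0) (h : QCommute q a b) : QCommute q⁻¹ b a := by
  rw [QCommute] at *
  rw [h, inv_smul_smul₀ hq]

theorem not_mem_center (hq : q ≠ 1) (hab : a * b ≠ 0) (h : QCommute q a b) :
    b ∉ Subalgebra.center F A := by
  intro hb
  rw [QCommute, ← Subalgebra.mem_center_iff.mp hb a] at h
  have hzero : (q - 1) • (a * b) = 0 := by rw [sub_smul, one_smul, ← h, sub_self]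
  exact (smul_ne_zero (sub_ne_zero.mpr hq) hab) hzero

/-- The `b i` are eigenvectors of `b ↦ a⁻¹ b a` for distinct eigenvalues. -/
theorem eq_zero_of_sum_eq_zero {ι : Type*} {s : Finset ι} {q : ι → F} (hq : Set.InjOn q s)
    {b : ι → A} (ha : IsUnit a) (hb : ∀ i ∈ s, QCommute (q i) a (b i))
    (hsum : ∑ i ∈ s, b i = 0) {i : ι} (hi : i ∈ s) : b i = 0 := by
  obtain ⟨u, rfl⟩ := ha
  let conj : Module.End F A := LinearMap.mulLeft F (u⁻¹ : Aˣ).val * LinearMap.mulRight F u.val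
  have hconj (i : ι) (hi : i ∈ s) : conj (b i) = q i • b i := by
    simp only [conj, Module.End.mul_apply, LinearMap.mulRight_apply, LinearMap.mulLeft_apply]
    rw [hb i hi, mul_smul_comm, Units.inv_mul_cancel_left]
  refine (iSupIndep_iff_finsetSum_eq_zero_imp_eq_zero _).mp
    (conj.eigenspaces_iSupIndep.comp hq.injective) Finset.univ (fun i => b i) (fun i _ => ?_) ?_
    ⟨i, hi⟩ (Finset.mem_univ _)
  · exact Module.End.mem_eigenspace_iff.mpr (hconj i i.2)
  · rwa [← Finset.sum_coe_sort] at hsum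

end Field

section DivisionRing

variable {F D : Type*} [Field F] [DivisionRing D] [Algebra F D] {q : F} {a b : D}

theorem inv_right (hb : b ≠ 0) (hq : q ≠ 0) (h : QCommute q a b) : QCommute q⁻¹ a b⁻¹ := by
  rw [QCommute] at *
  rw [eq_inv_smul_iff₀ hq]
  apply mul_left_cancel₀ hb
  apply mul_right_cancel₀ hb
  rw [← mul_assoc b a, h]
  simp [hb]

end DivisionRing

end QCommute

end QCommute

section Graph

variable {F A B : Type*} [Field F] [Ring A] [Algebra F A] [Ring B] [Algebra F B] {p : ℕ}

/-- Adjacency in the graph whose paths are the Rost chains: two vertices that commute up to a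
`p`-th root of unity. This is weight `1` in a form that is visibly symmetric and does not refer
to decompositions. -/
def RostAdj (F : Type*) {A : Type*} [Field F] [Ring A] [Algebra F A] (p : ℕ) (a b : A) : Prop :=
  IsVertex F p a ∧ IsVertex F p b ∧ ∃ ω : F, ω ^ p = 1 ∧ QCommute ω a b

theorem RostAdj.symm [NeZero p] {a b : A} (h : RostAdj F p a b) : RostAdj F p b a := by
  obtain ⟨ha, hb, ω, hω, hab⟩ := h
  exact ⟨hb, ha, ω⁻¹, by rw [inv_pow, hω, inv_one],
    hab.symm (IsUnit.of_pow_eq_one hω (NeZero.ne p)).ne_zero⟩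

instance [NeZero p] : Std.Symm (RostAdj F p (A := A)) :=
  ⟨fun _ _ => RostAdj.symm⟩

theorem label_eq [NeZero p] {ρ : F} (hρ : IsPrimitiveRoot ρ p) {x z : A} (hx : IsVertex F p x)
    {c : ZMod p → A} (hc : IsDecomposition p ρ x z c) : label p ρ x z = {i | c i ≠ 0} := by
  ext i
  refine ⟨?_, fun hi => ⟨c, hc, hi⟩⟩
  rintro ⟨d, hd, hi⟩
  rwa [(existsUnique_isDecomposition p hρ hx z).unique hd hc] at hi

theorem weight_eq_one_of_qCommute [NeZero p] {ρ : F} (hρ : IsPrimitiveRoot ρ p) {a b : A}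
    (ha : IsVertex F p a) (hb : b ≠ 0) {ω : F} (hω : ω ^ p = 1) (h : QCommute ω a b) :
    weight p ρ a b = 1 := by
  obtain ⟨m, hm, rfl⟩ := hρ.eq_pow_of_pow_eq_one hω
  have hdecomp : IsDecomposition p ρ a b (Pi.single (m : ZMod p) b) := by
    refine ⟨fun i => ?_, by simp⟩
    by_cases hi : i = m
    · subst hi
      rw [Pi.single_eq_same, ZMod.val_cast_of_lt hm]
      exact h
    · simp [hi]
  rw [weight, label_eq hρ ha hdecomp, Set.ncard_eq_one]
  refine ⟨m, Set.ext fun i => ?_⟩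
  by_cases hi : i = m
  · subst hi; simpa using hb
  · simp [hi]

theorem rostConnected_of_reflTransGen [Nontrivial A] [NeZero p] {ρ : F}
    (hρ : IsPrimitiveRoot ρ p) {x z : A} (hx : IsVertex F p x)
    (h : Relation.ReflTransGen (RostAdj F p) x z) : RostConnected p ρ x z := by
  induction h with
  | refl => exact ⟨0, fun _ => x, rfl, rfl, fun _ _ => hx, by simp⟩
  | @tail b d _ hbd ih =>
    obtain ⟨n, c, hstart, hend, hvertex, hweight⟩ := ih
    obtain ⟨hb, hd, ω, hω, hcomm⟩ := hbd
    refine ⟨n + 1, fun k => if k ≤ n then c k else d, by simp [hstart], by simp, ?_, ?_⟩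
    · intro k _
      dsimp only
      split_ifs with hk
      · exact hvertex k hk
      · exact hd
    · intro k hk
      rcases Nat.lt_succ_iff_lt_or_eq.mp hk with hk | rfl
      · simpa [hk.le, Nat.succ_le_of_lt hk] using hweight k hk
      · simpa [hend] using weight_eq_one_of_qCommute hρ hb hd.2.ne_zero hω hcomm

theorem isVertex_of_pow_mem_center [Fact p.Prime] {w : A} (hunit : IsUnit w)
    (hpow : w ^ p ∈ Subalgebra.center F A) (hw : w ∉ Subalgebra.center F A) : IsVertex F p w := by
  refine ⟨⟨hw, hpow, fun k hk hkp hmem => hw ?_⟩, hunit⟩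
  obtain ⟨u, rfl⟩ := hunit
  have hcoprime : k.gcd p = 1 :=
    (Nat.coprime_of_lt_prime (Nat.one_le_iff_ne_zero.mp hk) hkp Fact.out).symm
  have hbezout : u = (u ^ k) ^ k.gcdA p * (u ^ p) ^ k.gcdB p := by
    rw [← zpow_natCast, ← zpow_natCast u p, ← zpow_mul, ← zpow_mul, ← zpow_add,
      ← Nat.gcd_eq_gcd_ab, hcoprime, Nat.cast_one, zpow_one]
  have hcommute {m : ℕ} (hm : (u : A) ^ m ∈ Subalgebra.center F A) (b : A) :
      Commute b ((u ^ m : Aˣ) : A) := by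
    rw [Units.val_pow_eq_pow_val]
    exact Subalgebra.mem_center_iff.mp hm b
  refine Subalgebra.mem_center_iff.mpr fun b => ?_
  rw [hbezout, Units.val_mul]
  exact ((hcommute hmem b).units_zpow_right _).mul_right ((hcommute hpow b).units_zpow_right _)

theorem map_mem_center_iff (e : A ≃ₐ[F] B) {a : A} :
    e a ∈ Subalgebra.center F B ↔ a ∈ Subalgebra.center F A := by
  simp only [Subalgebra.mem_center_iff, e.surjective.forall, ← map_mul, e.injective.eq_iff]

theorem IsVertex.map (e : A ≃ₐ[F] B) {x : A} (hx : IsVertex F p x) : IsVertex F p (e x) := by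
  simpa only [IsVertex, IsDCentral, ← map_pow, map_mem_center_iff, MulEquiv.isUnit_map] using hx

theorem RostAdj.map (e : A ≃ₐ[F] B) {x z : A} (h : RostAdj F p x z) :
    RostAdj F p (e x) (e z) := by
  obtain ⟨hx, hz, ω, hω, hcomm⟩ := h
  exact ⟨hx.map e, hz.map e, ω, hω, hcomm.map e.toAlgHom⟩

theorem reflTransGen_of_map (e : A ≃ₐ[F] B) {x z : A}
    (h : Relation.ReflTransGen (RostAdj F p) (e x) (e z)) :
    Relation.ReflTransGen (RostAdj F p) x z := by
  have hlift := h.lift e.symm fun _ _ hab => hab.map e.symm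
  simpa only [Function.onFun, AlgEquiv.symm_apply_apply] using hlift

theorem exists_eq_add_of_weight_eq_two [NeZero p] {ρ : F} (hρ : IsPrimitiveRoot ρ p) {x z : A}
    (hx : IsVertex F p x) (hw : weight p ρ x z = 2) :
    ∃ (q r : F) (y t : A), q ^ p = 1 ∧ r ^ p = 1 ∧ q ≠ r ∧ (0 ∈ label p ρ x z ↔ q = 1 ∨ r = 1) ∧
      z = y + t ∧ y ≠ 0 ∧ t ≠ 0 ∧ QCommute q x y ∧ QCommute r x t := by
  obtain ⟨c, ⟨hcomm, hsum⟩, -⟩ := existsUnique_isDecomposition p hρ hx z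
  have hlabel := label_eq hρ hx ⟨hcomm, hsum⟩
  obtain ⟨i, j, hij, hset⟩ := Set.ncard_eq_two.mp hw
  have hne (l : ZMod p) : c l ≠ 0 ↔ l = i ∨ l = j := by
    simpa using Set.ext_iff.mp (hlabel.symm.trans hset) l
  have hroot (l : ZMod p) : (ρ ^ l.val) ^ p = 1 := by rw [pow_right_comm, hρ.pow_eq_one, one_pow]
  have hinj : Function.Injective fun l : ZMod p => ρ ^ l.val := fun l m h =>
    ZMod.val_injective p (hρ.pow_inj l.val_lt m.val_lt h)
  have hone (l : ZMod p) : ρ ^ l.val = 1 ↔ 0 = l := by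
    rw [eq_comm (a := 0), ← hinj.eq_iff, ZMod.val_zero, pow_zero]
  refine ⟨_, _, c i, c j, hroot i, hroot j, hinj.ne hij, ?_, ?_, (hne i).mpr (.inl rfl),
    (hne j).mpr (.inr rfl), hcomm i, hcomm j⟩
  · rw [hset, Set.mem_insert_iff, Set.mem_singleton_iff, hone, hone]
  · rw [← hsum]
    refine Fintype.sum_eq_add i j hij fun l hl => ?_
    rw [← not_ne_iff, hne]
    exact not_or.mpr hl

/-- The summands with index `i ≠ 0` of `x` with respect to `z` contribute multiples of
`∑ j, (ρ ^ i) ^ j = 0`. -/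
theorem sum_pow_mul_mul_pow_eq_zero [NeZero p] {ρ : F} (hρ : IsPrimitiveRoot ρ p) {x z : A}
    (hz : IsVertex F p z) (h0 : 0 ∉ label p ρ z x) :
    ∑ j ∈ Finset.range p, z ^ j * x * z ^ (p - 1 - j) = 0 := by
  obtain ⟨c, ⟨hcomm, hsum⟩, -⟩ := existsUnique_isDecomposition p hρ hz x
  rw [label_eq hρ hz ⟨hcomm, hsum⟩, Set.mem_ofPred_eq, not_not] at h0
  simp only [← hsum, Finset.mul_sum, Finset.sum_mul]
  rw [Finset.sum_comm]
  refine Finset.sum_eq_zero fun i _ => ?_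
  by_cases hi : i = 0
  · simp [hi, h0]
  classical
  have hroot : (ρ ^ i.val) ^ p = 1 := by rw [pow_right_comm, hρ.pow_eq_one, one_pow]
  have hne : ρ ^ i.val ≠ 1 := hρ.pow_ne_one_of_pos_of_lt (by simpa using hi) (ZMod.val_lt i)
  rw [QCommute.sum_pow_mul_mul_pow (hcomm i), sum_pow_eq_ite p hroot, if_neg hne, zero_smul]

end Graph

section Split

open Module Polynomial

variable {F V : Type*} [Field F] [AddCommGroup V] [Module F V] {p : ℕ}

/-- When `φ v = 1`, the endomorphism with eigenvalue `ρ` on `v` and `1` on the kernel of `φ`. These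
are the vertices through which all others get connected in a split algebra. -/
def dilation (ρ : F) (φ : Dual F V) (v : V) : End F V :=
  LinearMap.transvection φ ((ρ - 1) • v)

theorem dilation_apply (ρ : F) (φ : Dual F V) (v w : V) :
    dilation ρ φ v w = w + φ w • (ρ - 1) • v :=
  rfl

theorem dilation_pow (ρ : F) {φ : Dual F V} {v : V} (hv : φ v = 1) (n : ℕ) :
    dilation ρ φ v ^ n = dilation (ρ ^ n) φ v := by
  induction n with
  | zero => ext; simp [dilation_apply]
  | succ n ih =>
    rw [pow_succ, ih, dilation, dilation, Module.End.mul_eq_comp,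
      LinearMap.transvection.comp_smul_smul, hv, dilation]
    congr 2
    ring

theorem isVertex_dilation [Fact p.Prime] {ρ : F} (hρ : IsPrimitiveRoot ρ p)
    (hV : 1 < finrank F V) {φ : Dual F V} {v : V} (hv : φ v = 1) :
    IsVertex F p (dilation ρ φ v) := by
  have hp : p.Prime := Fact.out
  have : Module.Finite F V := Module.finite_of_finrank_pos (by lia)
  have hpow : dilation ρ φ v ^ p = 1 := by
    rw [dilation_pow ρ hv, hρ.pow_eq_one]
    ext; simp [dilation_apply]
  refine isVertex_of_pow_mem_center (.of_pow_eq_one hpow hp.ne_zero) (hpow ▸ one_mem _) fun hc => ?_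
  obtain ⟨a, ha⟩ := (Algebra.IsCentral.mem_center_iff F).mp hc
  have happly (w : V) : w + φ w • (ρ - 1) • v = a • w := by
    rw [← dilation_apply, ha, Module.algebraMap_end_apply]
  obtain ⟨u, hu, hu0⟩ := Submodule.exists_mem_ne_zero_of_ne_bot
    (LinearMap.ker_ne_bot_of_finrank_lt (f := φ) (by rwa [finrank_self]))
  have ha1 : a = 1 := by
    have := happly u
    rw [LinearMap.mem_ker.mp hu, zero_smul, add_zero] at this
    exact smul_left_injective F hu0 (by simpa using this.symm)
  have hφv := congrArg φ (happly v)
  simp only [ha1, map_add, map_smul, hv, one_smul, smul_eq_mul, mul_one] at hφv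
  exact hρ.ne_one hp.one_lt (by linear_combination hφv)

theorem rostAdj_dilation [Fact p.Prime] {ρ : F} (hρ : IsPrimitiveRoot ρ p)
    (hV : 1 < finrank F V) {φ φ' : Dual F V} {v v' : V} (hv : φ v = 1) (hv' : φ' v' = 1)
    (hφv' : φ v' = 0) (hφ'v : φ' v = 0) :
    RostAdj F p (dilation ρ φ v) (dilation ρ φ' v') := by
  refine ⟨isVertex_dilation hρ hV hv, isVertex_dilation hρ hV hv', 1, one_pow p, .of_commute ?_⟩
  ext w
  simp only [End.mul_apply, dilation_apply, map_add, map_smul, hφv', hφ'v]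
  module

theorem reflTransGen_dilation [Fact p.Prime] {ρ : F} (hρ : IsPrimitiveRoot ρ p)
    (hV : 4 < finrank F V) {φ φ' : Dual F V} {v v' : V} (hv : φ v = 1) (hv' : φ' v' = 1) :
    Relation.ReflTransGen (RostAdj F p) (dilation ρ φ v) (dilation ρ φ' v') := by
  have : Module.Finite F V := Module.finite_of_finrank_pos (by lia)
  have hspan : finrank F (Submodule.span F {v, v'}) ≤ 2 := by
    classical
    rw [← Finset.coe_pair]
    exact (finrank_span_finset_le_card _).trans Finset.card_le_two
  have hker : finrank F V ≤ 2 + finrank F (LinearMap.ker (φ.prod φ')) := by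
    rw [← LinearMap.finrank_range_add_finrank_ker (φ.prod φ')]
    gcongr
    simpa using Submodule.finrank_le (LinearMap.range (φ.prod φ'))
  have hnle : ¬ LinearMap.ker (φ.prod φ') ≤ Submodule.span F {v, v'} := fun hle => by
    have := Submodule.finrank_mono hle
    lia
  obtain ⟨w, hw, hwspan⟩ := SetLike.not_le_iff_exists.mp hnle
  obtain ⟨hφw, hφ'w⟩ : φ w = 0 ∧ φ' w = 0 := by simpa using hw
  obtain ⟨f, hfw, hf⟩ := Submodule.exists_le_ker_of_notMem hwspan
  have hfv : f v = 0 := hf (Submodule.subset_span (by simp))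
  have hfv' : f v' = 0 := hf (Submodule.subset_span (by simp))
  have hw1 : ((f w)⁻¹ • f) w = 1 := by simp [hfw]
  exact .tail (.single (rostAdj_dilation hρ (by lia) hv hw1 hφw (by simp [hfv])))
    (rostAdj_dilation hρ (by lia) hw1 hv' (by simp [hfv']) hφ'w)

/-- A power of `x` that is scalar and prime to the characteristic makes `x` semisimple. -/
theorem notMem_range_sub_of_hasEigenvector {x : End F V} {α : F} {n : ℕ} (hn : (n : F) ≠ 0)
    (hx : x ^ n = algebraMap F _ α) {a : F} (ha : a ≠ 0) {v : V} (hv : x.HasEigenvector a v) :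
    v ∉ LinearMap.range (x - algebraMap F _ a) := by
  rintro ⟨w, hw⟩
  have hxw : x w = a • w + v := by
    rw [← hw, LinearMap.sub_apply, algebraMap_end_apply, add_sub_cancel]
  have hpow (m : ℕ) : (x ^ m) w = a ^ m • w + (m * a ^ (m - 1)) • v := by
    induction m with
    | zero => simp
    | succ m ih =>
      rw [pow_succ', End.mul_apply, ih, map_add, map_smul, map_smul, hxw, hv.apply_eq_smul]
      rcases m with _ | m
      · simp
      · simp only [Nat.add_sub_cancel, Nat.cast_add, Nat.cast_one]
        module
  have hα : α = a ^ n := by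
    refine smul_left_injective F hv.2 ?_
    dsimp only
    rw [← hv.pow_apply, hx, algebraMap_end_apply]
  have hzero : (n * a ^ (n - 1)) • v = 0 := by
    have := hpow n
    rwa [hx, algebraMap_end_apply, hα, left_eq_add] at this
  exact smul_ne_zero (mul_ne_zero hn (pow_ne_zero _ ha)) hv.2 hzero

theorem exists_rostAdj_dilation_of_hasEigenvector [Fact p.Prime] {ρ : F}
    (hρ : IsPrimitiveRoot ρ p) (hV : 1 < finrank F V) {x : End F V} (hx : IsVertex F p x) {a : F}
    {v : V} (hv : x.HasEigenvector a v) :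
    ∃ (φ : Dual F V) (u : V), φ u = 1 ∧ RostAdj F p x (dilation ρ φ u) := by
  have ha : a ≠ 0 := by
    rintro rfl
    refine hv.2 (((End.isUnit_iff x).mp hx.2).injective ?_)
    rw [hv.apply_eq_smul, zero_smul, map_zero]
  obtain ⟨α, hα⟩ := (Algebra.IsCentral.mem_center_iff F).mp hx.1.2.1
  obtain ⟨f, hfv, hf⟩ := Submodule.exists_le_ker_of_notMem
    (notMem_range_sub_of_hasEigenvector hρ.neZero'.out hα ha hv)
  have hfx (w : V) : f (x w) = a * f w := by
    have : f ((x - algebraMap F _ a) w) = 0 := hf (LinearMap.mem_range_self _ w)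
    simpa [sub_eq_zero] using this
  have hφv : ((f v)⁻¹ • f) v = 1 := by simp [hfv]
  refine ⟨_, v, hφv, hx, isVertex_dilation hρ hV hφv, 1, one_pow p, .of_commute ?_⟩
  ext w
  simp only [End.mul_apply, dilation_apply, map_add, map_smul, hv.apply_eq_smul, hfx,
    LinearMap.smul_apply, smul_eq_mul]
  module

theorem linearIndependent_pow_apply_of_irreducible {x : End F V} {f : F[X]} (hf : Irreducible f)
    (hx : aeval x f = 0) {v : V} (hv : v ≠ 0) :
    LinearIndependent F (fun n : Fin f.natDegree => (x ^ (n : ℕ)) v) := by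
  rw [Fintype.linearIndependent_iff]
  intro c hc
  let g : F[X] := ∑ n : Fin f.natDegree, C (c n) * X ^ (n : ℕ)
  have hgv : aeval x g v = 0 := by
    simpa [g, ← Algebra.smul_def] using hc
  have hdeg : g.degree < f.degree := by
    rw [degree_eq_natDegree hf.ne_zero]
    exact degree_sum_fin_lt c
  have hg : g = 0 := by
    by_contra hg
    obtain ⟨s, t, hst⟩ : IsCoprime f g :=
      hf.coprime_iff_not_dvd.mpr fun hdvd => hg (eq_zero_of_dvd_of_degree_lt hdvd hdeg)
    have := congrArg (fun h => aeval x h v) hst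
    simp only [map_add, map_mul, hx, mul_zero, LinearMap.add_apply, LinearMap.zero_apply,
      End.mul_apply, hgv, map_zero, add_zero, map_one, End.one_apply] at this
    exact hv this.symm
  intro n
  have := congrArg (fun h => coeff h (n : ℕ)) hg
  simpa [g, finsetSum_coeff, coeff_C_mul, coeff_X_pow, ← Fin.ext_iff] using this

theorem exists_hasEigenvector_of_pow_eq [Nontrivial V] [Module.Finite F V] [NeZero p] {ρ : F}
    (hρ : IsPrimitiveRoot ρ p) {x : End F V} {b : F} (hx : x ^ p = algebraMap F _ (b ^ p)) :
    ∃ (a : F) (v : V), x.HasEigenvector a v := by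
  have hroot : aeval x (X ^ p - C (b ^ p) : F[X]) = 0 := by
    rw [map_sub, map_pow, aeval_X, aeval_C, hx, sub_self]
  have hsplits : (minpoly F x).Splits :=
    (X_pow_sub_C_splits_of_isPrimitiveRoot hρ rfl).of_dvd
      (X_pow_sub_C_ne_zero (NeZero.pos p) _) (minpoly.dvd F x hroot)
  obtain ⟨a, ha⟩ := hsplits.exists_eval_eq_zero
    (minpoly.degree_pos (Algebra.IsIntegral.isIntegral x)).ne'
  exact ⟨a, (End.hasEigenvalue_of_isRoot ha).exists_hasEigenvector⟩

/-- In the basis `v, x v, …, x ^ (p - 1) v` take `y = diag(1, ρ, …, ρ ^ (p - 1))`. -/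
theorem exists_rostAdj_hasEigenvector_of_irreducible [Fact p.Prime] {ρ : F}
    (hρ : IsPrimitiveRoot ρ p) (hV : finrank F V = p) {x : End F V} (hxv : IsVertex F p x) {α : F}
    (hx : x ^ p = algebraMap F _ α) (hirr : Irreducible (X ^ p - C α : F[X])) :
    ∃ (y : End F V) (v : V), RostAdj F p x y ∧ y.HasEigenvector 1 v := by
  have hp : p.Prime := Fact.out
  have : Nontrivial V := nontrivial_of_finrank_pos (R := F) (by rw [hV]; exact hp.pos)
  obtain ⟨v, hv⟩ := exists_ne (0 : V)
  have hli := linearIndependent_pow_apply_of_irreducible hirr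
    (by rw [map_sub, map_pow, aeval_X, aeval_C, hx, sub_self]) hv
  rw [natDegree_X_pow_sub_C] at hli
  let b := basisOfLinearIndependentOfCardEqFinrank hli (by rw [hV, Fintype.card_fin])
  have hb (n : Fin p) : b n = (x ^ (n : ℕ)) v := by simp [b]
  let y : End F V := b.constr F fun n => ρ ^ (n : ℕ) • b n
  have hyb (n : Fin p) : y (b n) = ρ ^ (n : ℕ) • b n := b.constr_basis F _ n
  have hyv : y v = (1 : F) • v := by simpa [hb] using hyb 0
  have hypow (n : ℕ) (hn : n ≤ p) : y ((x ^ n) v) = ρ ^ n • (x ^ n) v := by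
    rcases hn.lt_or_eq with hn | rfl
    · simpa [hb] using hyb ⟨n, hn⟩
    · rw [hx, algebraMap_end_apply, map_smul, hyv, hρ.pow_eq_one, one_smul, one_smul]
  have hxy : QCommute ρ x y := b.ext fun n => by
    have hxb : x (b n) = (x ^ (n + 1 : ℕ)) v := by rw [hb, pow_succ', End.mul_apply]
    rw [End.mul_apply, LinearMap.smul_apply, End.mul_apply, hyb, map_smul, hxb,
      hypow _ n.2, smul_smul, pow_succ']
  have hyp : y ^ p = 1 := b.ext fun n => by
    rw [End.HasEigenvector.pow_apply ⟨End.mem_eigenspace_iff.mpr (hyb n), b.ne_zero n⟩,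
      pow_right_comm, hρ.pow_eq_one, one_pow, one_smul, End.one_apply]
  have hyunit : IsUnit y := .of_pow_eq_one hyp hp.ne_zero
  have hyvertex : IsVertex F p y := isVertex_of_pow_mem_center hyunit (hyp ▸ one_mem _)
    (hxy.not_mem_center (hρ.ne_one hp.one_lt) (hxv.2.mul hyunit).ne_zero)
  exact ⟨y, v, ⟨hxv, hyvertex, ρ, hρ.pow_eq_one, hxy⟩, End.mem_eigenspace_iff.mpr hyv, hv⟩

theorem exists_reflTransGen_dilation [Fact p.Prime] {ρ : F} (hρ : IsPrimitiveRoot ρ p)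
    (hV : finrank F V = p) {x : End F V} (hx : IsVertex F p x) :
    ∃ (φ : Dual F V) (u : V), φ u = 1 ∧ Relation.ReflTransGen (RostAdj F p) x (dilation ρ φ u) := by
  have hp : p.Prime := Fact.out
  have hrank : 1 < finrank F V := hV ▸ hp.one_lt
  have : Nontrivial V := nontrivial_of_finrank_pos (R := F) (by lia)
  have : Module.Finite F V := Module.finite_of_finrank_pos (by lia)
  obtain ⟨α, hα⟩ := (Algebra.IsCentral.mem_center_iff F).mp hx.1.2.1
  by_cases hroot : ∃ b : F, b ^ p = α
  · obtain ⟨b, rfl⟩ := hroot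
    obtain ⟨a, v, hv⟩ := exists_hasEigenvector_of_pow_eq hρ hα
    obtain ⟨φ, u, hu, hadj⟩ := exists_rostAdj_dilation_of_hasEigenvector hρ hrank hx hv
    exact ⟨φ, u, hu, .single hadj⟩
  · push Not at hroot
    obtain ⟨y, v, hxy, hv⟩ := exists_rostAdj_hasEigenvector_of_irreducible hρ hV hx hα
      (X_pow_sub_C_irreducible_of_prime hp hroot)
    obtain ⟨φ, u, hu, hadj⟩ := exists_rostAdj_dilation_of_hasEigenvector hρ hrank hxy.2.1 hv
    exact ⟨φ, u, hu, .tail (.single hxy) hadj⟩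

theorem reflTransGen_end [Fact p.Prime] (hp : 4 < p) {ρ : F} (hρ : IsPrimitiveRoot ρ p)
    (hV : finrank F V = p) {x z : End F V} (hx : IsVertex F p x) (hz : IsVertex F p z) :
    Relation.ReflTransGen (RostAdj F p) x z := by
  obtain ⟨φ, u, hu, hxu⟩ := exists_reflTransGen_dilation hρ hV hx
  obtain ⟨φ', u', hu', hzu'⟩ := exists_reflTransGen_dilation hρ hV hz
  exact (hxu.trans (reflTransGen_dilation hρ (hV ▸ hp) hu hu')).trans (symm_of _ hzu')

end Split

section Wedderburn

variable {F A : Type*} [Field F] [Ring A] [Algebra F A] {p : ℕ}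

theorem isUnit_or_eq_zero_or_nonempty_algEquiv_end [IsSimpleRing A] (hp : p.Prime)
    (hA : Module.finrank F A = p ^ 2) :
    (∀ a : A, IsUnit a ∨ a = 0) ∨ Nonempty (A ≃ₐ[F] Module.End F (Fin p → F)) := by
  have : Module.Finite F A := Module.finite_of_finrank_pos (hA ▸ pow_pos hp.pos 2)
  have : IsArtinianRing A := IsArtinianRing.of_finite F A
  obtain ⟨n, hn, D, _, _, _, ⟨e⟩⟩ :=
    IsSimpleRing.exists_algEquiv_matrix_divisionRing_finite F A
  have hdim := e.toLinearEquiv.finrank_eq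
  rw [hA, Module.finrank_matrix, Fintype.card_fin, ← pow_two] at hdim
  have hdvd : n ∣ p := (Nat.pow_dvd_pow_iff two_ne_zero).mp ⟨_, hdim⟩
  rcases (Nat.dvd_prime hp).mp hdvd with rfl | rfl
  · refine .inl fun a => or_iff_not_imp_right.mpr fun ha => ?_
    let e' : A ≃+* D := e.toRingEquiv.trans (Matrix.uniqueRingEquiv)
    exact (MulEquiv.isUnit_map e').mp (((map_ne_zero_iff e' e'.injective).mpr ha).isUnit)
  · have hD : Module.finrank F D = 1 :=
      Nat.eq_of_mul_eq_mul_left (pow_pos hp.pos 2) (by rw [← hdim, mul_one])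
    let e' : F ≃ₐ[F] D := AlgEquiv.ofBijective (Algebra.ofId F D)
      (Module.Free.bijective_algebraMap_of_finrank_eq_one hD)
    exact .inr ⟨(e.trans e'.symm.mapMatrix).trans Matrix.toLinAlgEquiv'⟩

end Wedderburn

section ShuffleSum

open Finset

variable {R A : Type*} [CommRing R] [Ring A] [Algebra R A]

/-- The sum of all products in which the letters of the list `l`, in this order, are interspersed
with `n` factors `y`. The homogeneous components of `(y + t) ^ n` are of this form. -/
def shuffleSum (y : A) : List A → ℕ → A
  | [], n => y ^ n
  | a :: l, 0 => a * shuffleSum y l 0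
  | a :: l, n + 1 => y * shuffleSum y (a :: l) n + a * shuffleSum y l (n + 1)

/-- The complete homogeneous symmetric polynomial of degree `n` in the products of the final
segments of the list, including the empty one. It is the coefficient that arises when all letters
of a shuffle sum are moved to the left. -/
def shuffleCoeff : List R → ℕ → R
  | [], _ => 1
  | _ :: _, 0 => 1
  | q :: qs, n + 1 => (q :: qs).prod * shuffleCoeff (q :: qs) n + shuffleCoeff qs (n + 1)

theorem shuffleCoeff_zero (l : List R) : shuffleCoeff l 0 = 1 := by
  cases l <;> rw [shuffleCoeff]

theorem QCommute.list_prod_left {y : A} {qs : List R} {l : List A}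
    (h : List.Forall₂ (fun q a => QCommute q a y) qs l) : QCommute qs.prod l.prod y := by
  induction h with
  | nil => exact .of_commute (.one_left y)
  | cons hqa _ ih => simpa only [List.prod_cons] using hqa.mul_left ih

theorem shuffleSum_eq_smul {y : A} {qs : List R} {l : List A}
    (h : List.Forall₂ (fun q a => QCommute q a y) qs l) (n : ℕ) :
    shuffleSum y l n = shuffleCoeff qs n • (l.prod * y ^ n) := by
  induction h generalizing n with
  | nil => simp [shuffleSum, shuffleCoeff]
  | @cons q a qs l hqa h ih =>
    induction n with
    | zero =>
      rw [shuffleSum, ih, shuffleCoeff_zero, shuffleCoeff_zero, one_smul, one_smul,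
        List.prod_cons, mul_assoc]
    | succ n ihn =>
      have hprod := QCommute.list_prod_left (.cons hqa h)
      rw [QCommute] at hprod
      rw [shuffleSum, ihn, ih, shuffleCoeff, mul_smul_comm, ← mul_assoc y, hprod, smul_mul_assoc,
        mul_assoc _ y, ← pow_succ', smul_smul, mul_comm (shuffleCoeff _ n), mul_smul_comm,
        ← mul_assoc a, ← List.prod_cons, ← add_smul]

theorem QCommute.shuffleSum {q : R} {x y : A} (hy : QCommute q x y) {rs : List R} {l : List A}
    (h : List.Forall₂ (fun r a => QCommute r x a) rs l) (n : ℕ) :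
    QCommute (rs.prod * q ^ n) x (shuffleSum y l n) := by
  induction h generalizing n with
  | nil => simpa [RostChains.shuffleSum] using hy.pow_right n
  | @cons r a rs l hra _ ih =>
    induction n with
    | zero => simpa [RostChains.shuffleSum, mul_assoc] using hra.mul_right (ih 0)
    | succ n ihn =>
      rw [RostChains.shuffleSum]
      refine .add_right ?_ ?_
      · convert hy.mul_right ihn using 1
        ring
      · convert hra.mul_right (ih (n + 1)) using 1
        rw [List.prod_cons, mul_assoc]

theorem shuffleSum_append_sum {ι : Type*} (y : A) (l₁ l₂ : List A) (s : Finset ι) (f : ι → A)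
    (n : ℕ) :
    shuffleSum y (l₁ ++ (∑ i ∈ s, f i) :: l₂) n = ∑ i ∈ s, shuffleSum y (l₁ ++ f i :: l₂) n := by
  induction l₁ generalizing n with
  | nil =>
    induction n with
    | zero => simp only [List.nil_append, shuffleSum, sum_mul]
    | succ n ih =>
      simp only [List.nil_append] at ih
      simp only [List.nil_append, shuffleSum, ih, mul_sum, sum_mul, sum_add_distrib]
  | cons a l₁ ih =>
    induction n with
    | zero => simp only [List.cons_append, shuffleSum, ih, mul_sum]
    | succ n ihn =>
      simp only [List.cons_append] at ihn
      simp only [List.cons_append, shuffleSum, ihn, ih, mul_sum, sum_add_distrib]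

theorem shuffleSum_replicate_zero (y t : A) (b : ℕ) :
    shuffleSum y (List.replicate b t) 0 = t ^ b := by
  induction b with
  | zero => simp [shuffleSum]
  | succ b ih => rw [List.replicate_succ, shuffleSum, ih, pow_succ']

theorem sum_antidiagonal_succ_of_pascal {y t : A} {f g : ℕ → ℕ → A}
    (hy : ∀ a, f 0 (a + 1) = y * f 0 a + g 0 (a + 1))
    (ht : ∀ b, f (b + 1) 0 = t * f b 0 + g (b + 1) 0)
    (hyt : ∀ b a, f (b + 1) (a + 1) = y * f (b + 1) a + t * f b (a + 1) + g (b + 1) (a + 1))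
    (n : ℕ) :
    ∑ i ∈ antidiagonal (n + 1), f i.1 i.2 =
      (y + t) * ∑ i ∈ antidiagonal n, f i.1 i.2 + ∑ i ∈ antidiagonal (n + 1), g i.1 i.2 := by
  let startY : ℕ → ℕ → A
    | _, 0 => 0
    | b, a + 1 => y * f b a
  let startT : ℕ → ℕ → A
    | 0, _ => 0
    | b + 1, a => t * f b a
  have hsplit : ∀ i ∈ antidiagonal (n + 1),
      f i.1 i.2 = startY i.1 i.2 + startT i.1 i.2 + g i.1 i.2 := by
    rintro ⟨_ | b, _ | a⟩ hi
    · simp at hi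
    · simpa [startY, startT] using hy a
    · simpa [startY, startT] using ht b
    · exact hyt b a
  rw [sum_congr rfl hsplit, sum_add_distrib, sum_add_distrib, Nat.sum_antidiagonal_succ',
    Nat.sum_antidiagonal_succ, add_mul, mul_sum, mul_sum, zero_add, zero_add]

theorem add_pow_eq_sum_shuffleSum (y t : A) (n : ℕ) :
    (y + t) ^ n = ∑ b ∈ range (n + 1), shuffleSum y (List.replicate b t) (n - b) := by
  rw [← Nat.sum_antidiagonal_eq_sum_range_succ fun b a => shuffleSum y (List.replicate b t) a]
  induction n with
  | zero => simp [shuffleSum]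
  | succ n ih =>
    rw [sum_antidiagonal_succ_of_pascal (y := y) (t := t)
      (f := fun b a => shuffleSum y (List.replicate b t) a) (g := 0), ← ih, pow_succ']
    · simp
    all_goals intros; simp [List.replicate_succ, shuffleSum, pow_succ']

/-- The sum of all products of `a` factors `y`, `b` factors `t` and one factor `x`, in any order.
The homogeneous components of `∑ j, (y + t) ^ j * x * (y + t) ^ (n - j)` are of this form. -/
def markedShuffleSum (x y t : A) (a b : ℕ) : A :=
  ∑ i ∈ range (b + 1), shuffleSum y (List.replicate i t ++ x :: List.replicate (b - i) t) a

theorem sum_add_pow_mul_mul_add_pow (x y t : A) (n : ℕ) :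
    ∑ j ∈ range (n + 1), (y + t) ^ j * x * (y + t) ^ (n - j) =
      ∑ b ∈ range (n + 1), markedShuffleSum x y t (n - b) b := by
  rw [← Nat.sum_antidiagonal_eq_sum_range_succ fun b a => markedShuffleSum x y t a b]
  induction n with
  | zero => simp [markedShuffleSum, shuffleSum]
  | succ n ih =>
    rw [sum_antidiagonal_succ_of_pascal (y := y) (t := t)
      (f := fun b a => markedShuffleSum x y t a b)
      (g := fun b a => x * shuffleSum y (List.replicate b t) a), ← ih, ← mul_sum,
      Nat.sum_antidiagonal_eq_sum_range_succ fun b a => shuffleSum y (List.replicate b t) a,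
      ← add_pow_eq_sum_shuffleSum, sum_range_succ', mul_sum]
    · simp [pow_succ', mul_assoc]
    · intro a
      simp [markedShuffleSum, shuffleSum]
    · intro b
      simp [markedShuffleSum, shuffleSum, sum_range_succ' _ (b + 1), List.replicate_succ, mul_sum]
    · intro b a
      simp only [markedShuffleSum, sum_range_succ' _ (b + 1), List.replicate_succ,
        Nat.reduceSubDiff, List.cons_append, shuffleSum, sum_add_distrib, List.replicate_zero,
        tsub_zero, List.nil_append, mul_add, mul_sum]
      abel

theorem QCommute.forall₂_replicate {r : R} {x t : A} (h : QCommute r x t) (n : ℕ) :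
    List.Forall₂ (fun s a => QCommute s x a) (List.replicate n r) (List.replicate n t) := by
  induction n with
  | zero => exact .nil
  | succ n ih => exact .cons h ih

theorem QCommute.markedShuffleSum {q r : R} {x y t : A} (hy : QCommute q x y)
    (ht : QCommute r x t) (a b : ℕ) :
    QCommute (r ^ b * q ^ a) x (markedShuffleSum x y t a b) := by
  refine .sum_right fun i hi => ?_
  have hletters := List.rel_append (ht.forall₂_replicate i)
    (.cons (.of_commute (.refl x)) (ht.forall₂_replicate (b - i)))
  convert hy.shuffleSum hletters a using 2
  rw [List.prod_append, List.prod_cons, List.prod_replicate, List.prod_replicate, one_mul,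
    ← pow_add, Nat.add_sub_cancel' (Nat.le_of_lt_succ (mem_range.mp hi))]

end ShuffleSum

section Components

variable {F A : Type*} [Field F] [Ring A] [Algebra F A] {p : ℕ} {q r : F} {x y t : A}

theorem isPrimitiveRoot_of_pow_eq_one [Fact p.Prime] {ω : F} (hω : ω ^ p = 1) (hne : ω ≠ 1) :
    IsPrimitiveRoot ω p :=
  IsPrimitiveRoot.iff_orderOf.mpr (orderOf_eq_prime hω hne)

theorem injOn_pow_mul_pow_sub [Fact p.Prime] (hq : q ^ p = 1) (hr : r ^ p = 1) (hqr : q ≠ r)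
    {n : ℕ} (hn : p ≤ n + 1) : Set.InjOn (fun b => r ^ b * q ^ (n - b)) (Finset.range p) := by
  have hq0 : q ≠ 0 := (IsUnit.of_pow_eq_one hq (NeZero.ne p)).ne_zero
  have hprim : IsPrimitiveRoot (r / q) p :=
    isPrimitiveRoot_of_pow_eq_one (by rw [div_pow, hq, hr, div_one]) (div_ne_one_of_ne hqr.symm)
  have hratio (b : ℕ) (hb : b < p) : r ^ b * q ^ (n - b) = (r / q) ^ b * q ^ n := by
    rw [div_pow, ← pow_sub_mul_pow q (show b ≤ n by lia)]
    field_simp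
  intro b hb c hc hbc
  have hb := Finset.mem_range.mp hb
  have hc := Finset.mem_range.mp hc
  dsimp only at hbc
  rw [hratio b hb, hratio c hc] at hbc
  exact hprim.pow_inj hb hc (mul_right_cancel₀ (pow_ne_zero n hq0) hbc)

/-- The shuffle sums are eigenvectors of conjugation by `x` for distinct eigenvalues, and only the
eigenvalue `1` occurs in `(y + t) ^ p`. -/
theorem shuffleSum_replicate_eq_zero [Fact p.Prime] (hx : IsUnit x) (hq : q ^ p = 1)
    (hr : r ^ p = 1) (hqr : q ≠ r) (hy : QCommute q x y) (ht : QCommute r x t)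
    (hz : (y + t) ^ p ∈ Subalgebra.center F A) {a b : ℕ} (ha : a ≠ 0) (hb : b ≠ 0)
    (hab : a + b = p) : shuffleSum y (List.replicate b t) a = 0 := by
  let S (b : ℕ) : A := shuffleSum y (List.replicate b t) (p - b)
  have hS0 : S 0 = y ^ p := by simp [S, shuffleSum]
  have hS (b : ℕ) : QCommute (r ^ b * q ^ (p - b)) x (S b) := by
    simpa using hy.shuffleSum (ht.forall₂_replicate b) (p - b)
  let c (b : ℕ) : A := if b = 0 then y ^ p + t ^ p + (-1 : F) • (y + t) ^ p else S b
  have hc (b : ℕ) : QCommute (r ^ b * q ^ (p - b)) x (c b) := by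
    by_cases hb : b = 0
    · have hyp := hy.pow_right p
      have htp := ht.pow_right p
      rw [hq] at hyp
      rw [hr] at htp
      simpa [c, hb, hq] using (hyp.add_right htp).add_right
        ((QCommute.of_commute (Subalgebra.mem_center_iff.mp hz x)).smul_right (-1))
    · simpa [c, hb] using hS b
  have hsum : ∑ b ∈ Finset.range p, c b = 0 := by
    obtain ⟨n, rfl⟩ := Nat.exists_eq_succ_of_ne_zero (NeZero.ne p)
    have hpow := add_pow_eq_sum_shuffleSum y t (n + 1)
    rw [Finset.sum_range_succ, Nat.sub_self, shuffleSum_replicate_zero,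
      Finset.sum_range_succ'] at hpow
    rw [Finset.sum_range_succ']
    simp only [c, S, if_true, Nat.add_eq_zero_iff, one_ne_zero, and_false, if_false]
    rw [hpow, ← hS0]
    module
  have hzero := QCommute.eq_zero_of_sum_eq_zero
    (injOn_pow_mul_pow_sub hq hr hqr p.le_succ) hx (fun b _ => hc b) hsum
    (Finset.mem_range.mpr (show b < p by lia))
  simpa [c, hb, S, ← hab] using hzero

theorem markedShuffleSum_eq_zero [Fact p.Prime] (hx : IsUnit x) (hq : q ^ p = 1) (hr : r ^ p = 1)
    (hqr : q ≠ r) (hy : QCommute q x y) (ht : QCommute r x t)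
    (hz : ∑ j ∈ Finset.range p, (y + t) ^ j * x * (y + t) ^ (p - 1 - j) = 0) {b : ℕ}
    (hb : b < p) : markedShuffleSum x y t (p - 1 - b) b = 0 := by
  obtain ⟨n, rfl⟩ := Nat.exists_eq_succ_of_ne_zero (NeZero.ne p)
  rw [Nat.succ_sub_one, sum_add_pow_mul_mul_add_pow] at hz
  exact QCommute.eq_zero_of_sum_eq_zero (injOn_pow_mul_pow_sub hq hr hqr le_rfl) hx
    (fun b _ => hy.markedShuffleSum ht (n - b) b) hz (Finset.mem_range.mpr hb)

end Components

section ShuffleCoeff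

variable {R F : Type*} [CommRing R] [Field F] {p : ℕ}

theorem shuffleCoeff_concat_succ (l : List R) (c : R) (n : ℕ) :
    shuffleCoeff (l ++ [c]) (n + 1) =
      c ^ (n + 1) * shuffleCoeff l (n + 1) + shuffleCoeff (l ++ [c]) n := by
  induction l generalizing n with
  | nil =>
    induction n with
    | zero => simp [shuffleCoeff]
    | succ n ih =>
      simp only [List.nil_append, shuffleCoeff, List.prod_singleton] at ih ⊢
      linear_combination c * ih
  | cons a l ih =>
    induction n with
    | zero =>
      have := ih 0
      simp only [List.cons_append, shuffleCoeff, shuffleCoeff_zero, List.prod_cons,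
        List.prod_append, List.prod_nil] at this ⊢
      linear_combination this
    | succ n ihn =>
      have := ih (n + 1)
      simp only [List.cons_append, shuffleCoeff, List.prod_cons, List.prod_append,
        List.prod_nil] at ihn this ⊢
      linear_combination this + a * l.prod * c * ihn

theorem prod_sub_one_mul_shuffleCoeff (a c : R) (l : List R) (n : ℕ) :
    ((a :: (l ++ [c])).prod - 1) * shuffleCoeff (a :: (l ++ [c])) n =
      c ^ (n + 1) * shuffleCoeff (a :: l) (n + 1) - shuffleCoeff (l ++ [c]) (n + 1) := by
  have hlast := shuffleCoeff_concat_succ (a :: l) c n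
  rw [List.cons_append] at hlast
  have hfirst : shuffleCoeff (a :: (l ++ [c])) (n + 1) = (a :: (l ++ [c])).prod *
    shuffleCoeff (a :: (l ++ [c])) n + shuffleCoeff (l ++ [c]) (n + 1) := by rw [shuffleCoeff]
  linear_combination hlast - hfirst

/-- A complete homogeneous polynomial at distinct points is a divided difference of a monomial,
here of `X ^ p`, which is constant on the `p`-th roots of unity. -/
theorem shuffleCoeff_eq_zero {l : List F} (hl : l ≠ []) (hroot : ∀ a ∈ l, a ^ p = 1)
    (hprod : ∀ m, m <:+: l → m ≠ [] → m.prod ≠ 1) {n : ℕ} (hn : n + l.length = p) :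
    shuffleCoeff l n = 0 := by
  obtain ⟨a, l, rfl⟩ := List.exists_cons_of_ne_nil hl
  rcases l.eq_nil_or_concat' with rfl | ⟨m, c, rfl⟩
  · have hsucc := shuffleCoeff_concat_succ [] a n
    simp only [List.nil_append, shuffleCoeff, List.prod_singleton] at hsucc
    have ha : a ^ (n + 1) = 1 := hn ▸ hroot a (by simp)
    have hne : a - 1 ≠ 0 := sub_ne_zero.mpr (by simpa using hprod [a] List.infix_rfl hl)
    exact (mul_eq_zero.mp (by linear_combination hsucc + ha)).resolve_left hne
  · simp only [List.length_cons, List.length_append, List.length_nil] at hn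
    have hinit : a :: m <:+: a :: (m ++ [c]) := ⟨[], [c], by simp⟩
    have htail : m ++ [c] <:+: a :: (m ++ [c]) := ⟨[a], [], by simp⟩
    have hzero₁ : shuffleCoeff (a :: m) (n + 1) = 0 :=
      shuffleCoeff_eq_zero (by simp) (fun b hb => hroot b (hinit.subset hb))
        (fun k hk => hprod k (hk.trans hinit)) (by simp; lia)
    have hzero₂ : shuffleCoeff (m ++ [c]) (n + 1) = 0 :=
      shuffleCoeff_eq_zero (by simp) (fun b hb => hroot b (htail.subset hb))
        (fun k hk => hprod k (hk.trans htail)) (by simp; lia)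
    have hmul := prod_sub_one_mul_shuffleCoeff a c m n
    rw [hzero₁, hzero₂, mul_zero, sub_zero] at hmul
    exact (mul_eq_zero.mp hmul).resolve_left (sub_ne_zero.mpr (hprod _ List.infix_rfl hl))
termination_by l.length

theorem shuffleCoeff_map_pow_eq_zero {ρ : F} (hρ : IsPrimitiveRoot ρ p) {e : List ℕ} (he : e ≠ [])
    (hsum : ∀ m ∈ e.tails.flatMap List.inits, m ≠ [] → ¬ p ∣ m.sum) {n : ℕ}
    (hn : n + e.length = p) :
    shuffleCoeff (e.map (ρ ^ ·)) n = 0 := by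
  refine shuffleCoeff_eq_zero (p := p) (by simpa) ?_ ?_ (by simpa)
  · simp only [List.mem_map]
    rintro _ ⟨i, -, rfl⟩
    rw [pow_right_comm, hρ.pow_eq_one, one_pow]
  · intro m hm hm0
    obtain ⟨k, hk, rfl⟩ := List.infix_map_iff.mp hm
    have hprod : (k.map (ρ ^ ·)).prod = ρ ^ k.sum := by
      clear hk hm hm0
      induction k <;> simp_all [pow_add]
    rw [hprod, Ne, hρ.pow_eq_one_iff_dvd]
    obtain ⟨s, hks, hse⟩ := List.infix_iff_prefix_suffix.mp hk
    exact hsum k (List.mem_flatMap.mpr ⟨s, (List.mem_tails _ _).mpr hse,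
      (List.mem_inits _ _).mpr hks⟩) (by simpa using hm0)

end ShuffleCoeff

section Letters

open Finset

variable {F A : Type*} [Field F] [Ring A] [Algebra F A] {ρ κ q r : F} {x y a b t : A} {T : ℕ → A}

/-- The coefficient that arises when `x`, which is placed anywhere in the list of letters `a`, `b`
of a shuffle sum, is moved to the front. Here `ρ`, `q`, `r` are the scalars by which `x`, `a`, `b`
commute with the inserted letter, and `κ` the one by which `x` commutes with `a` and `b`. -/
def markedCoeff (ρ κ q r : F) (n : ℕ) : F :=
  shuffleCoeff [ρ, q, r] n + κ * shuffleCoeff [q, ρ, r] n + κ ^ 2 * shuffleCoeff [q, r, ρ] n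

theorem shuffleSum_pair_add (hy : QCommute ρ x y) (hxa : QCommute κ x a) (ha : QCommute q a y)
    (n : ℕ) :
    shuffleSum y [x, a] n + shuffleSum y [a, x] n =
      (shuffleCoeff [ρ, q] n + κ * shuffleCoeff [q, ρ] n) • (x * (a * y ^ n)) := by
  rw [shuffleSum_eq_smul (.cons hy (.cons ha .nil)), shuffleSum_eq_smul (.cons ha (.cons hy .nil))]
  rw [QCommute] at hxa
  simp only [List.prod_cons, List.prod_nil, mul_one, hxa, smul_mul_assoc, mul_assoc]
  module

theorem shuffleSum_triple_add (hy : QCommute ρ x y) (hxa : QCommute κ x a) (hxb : QCommute κ x b)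
    (ha : QCommute q a y) (hb : QCommute r b y) (n : ℕ) :
    shuffleSum y [x, a, b] n + shuffleSum y [a, x, b] n + shuffleSum y [a, b, x] n =
      markedCoeff ρ κ q r n • (x * (a * b * y ^ n)) := by
  rw [shuffleSum_eq_smul (.cons hy (.cons ha (.cons hb .nil))),
    shuffleSum_eq_smul (.cons ha (.cons hy (.cons hb .nil))),
    shuffleSum_eq_smul (.cons ha (.cons hb (.cons hy .nil))), markedCoeff]
  rw [QCommute] at hxa hxb
  simp only [List.prod_cons, List.prod_nil, mul_one, hxb, mul_smul_comm, ← mul_assoc, hxa,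
    smul_mul_assoc]
  module

theorem shuffleSum_singleton_sum (hT : ∀ m, QCommute (ρ ^ m) (T m) y) (s : Finset ℕ) (n : ℕ) :
    shuffleSum y [∑ m ∈ s, T m] n = ∑ m ∈ s, shuffleCoeff [ρ ^ m] n • (T m * y ^ n) := by
  refine (shuffleSum_append_sum y [] [] s T n).trans (sum_congr rfl fun m _ => ?_)
  simpa using shuffleSum_eq_smul (.cons (hT m) .nil) n

theorem shuffleSum_pair_sum (hT : ∀ m, QCommute (ρ ^ m) (T m) y) (s : Finset ℕ) (n : ℕ) :
    shuffleSum y [∑ m ∈ s, T m, ∑ m ∈ s, T m] n =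
      ∑ m ∈ s, ∑ k ∈ s, shuffleCoeff [ρ ^ m, ρ ^ k] n • (T m * T k * y ^ n) := by
  refine (shuffleSum_append_sum y [] [_] s T n).trans (sum_congr rfl fun m _ => ?_)
  refine (shuffleSum_append_sum y [T m] [] s T n).trans (sum_congr rfl fun k _ => ?_)
  simpa using shuffleSum_eq_smul (.cons (hT m) (.cons (hT k) .nil)) n

theorem markedShuffleSum_one_sum (hy : QCommute ρ x y) (hT : ∀ m, QCommute (ρ ^ m) (T m) y)
    (hxT : ∀ m, QCommute κ x (T m)) (s : Finset ℕ) (n : ℕ) :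
    markedShuffleSum x y (∑ m ∈ s, T m) n 1 =
      ∑ m ∈ s, (shuffleCoeff [ρ, ρ ^ m] n + κ * shuffleCoeff [ρ ^ m, ρ] n) •
        (x * (T m * y ^ n)) := by
  have h₁ := shuffleSum_append_sum y [x] [] s T n
  have h₂ := shuffleSum_append_sum y [] [x] s T n
  simp only [List.cons_append, List.nil_append] at h₁ h₂
  simp only [markedShuffleSum, sum_range_succ, sum_range_zero, zero_add, List.replicate,
    List.cons_append, List.nil_append, Nat.reduceSub, h₁, h₂, ← sum_add_distrib,
    shuffleSum_pair_add hy (hxT _) (hT _)]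

theorem markedShuffleSum_two_sum (hy : QCommute ρ x y) (hT : ∀ m, QCommute (ρ ^ m) (T m) y)
    (hxT : ∀ m, QCommute κ x (T m)) (s : Finset ℕ) (n : ℕ) :
    markedShuffleSum x y (∑ m ∈ s, T m) n 2 =
      ∑ m ∈ s, ∑ k ∈ s, markedCoeff ρ κ (ρ ^ m) (ρ ^ k) n • (x * (T m * T k * y ^ n)) := by
  have h₁ (l : List A) := shuffleSum_append_sum y [] l s T n
  have h₂ (a : A) (l : List A) := shuffleSum_append_sum y [a] l s T n
  have h₃ (a b : A) := shuffleSum_append_sum y [a, b] [] s T n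
  simp only [List.cons_append, List.nil_append] at h₁ h₂ h₃
  simp only [markedShuffleSum, sum_range_succ, sum_range_zero, zero_add, List.replicate,
    List.cons_append, List.nil_append, Nat.reduceSub, h₁, h₂, h₃, ← sum_add_distrib,
    shuffleSum_triple_add hy (hxT _) (hxT _) (hT _) (hT _)]

end Letters

section FifthRoots

variable {F : Type*} [Field F] {ρ : F}

theorem five_ne_zero_of_isPrimitiveRoot (hρ : IsPrimitiveRoot ρ 5) : (5 : F) ≠ 0 := by
  simpa using (hρ.neZero' : NeZero ((5 : ℕ) : F)).out

theorem sum_pow_eq_zero (hρ : IsPrimitiveRoot ρ 5) : 1 + ρ + ρ ^ 2 + ρ ^ 3 + ρ ^ 4 = 0 := by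
  simpa [Finset.sum_range_succ] using hρ.geom_sum_eq_zero (by norm_num)

end FifthRoots

section Elimination

open Finset

variable {F A : Type*} [Field F] [Ring A] [NoZeroDivisors A] [Algebra F A] {ρ : F} {x y : A}
  {T : ℕ → A} {k : ℕ}

theorem markedCoeff_map_pow_eq_zero (hρ : IsPrimitiveRoot ρ 5) (κ : F) {m n : ℕ}
    (hmn : (m, n) = (1, 1) ∨ (m, n) = (1, 2) ∨ (m, n) = (2, 1) ∨ (m, n) = (3, 3)) :
    markedCoeff ρ κ (ρ ^ m) (ρ ^ n) 2 = 0 := by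
  have h (e : List ℕ) := shuffleCoeff_map_pow_eq_zero hρ (e := e) (n := 2)
  have h₁ := h [1, m, n]
  have h₂ := h [m, 1, n]
  have h₃ := h [m, n, 1]
  simp only [List.map_cons, List.map_nil, pow_one] at h₁ h₂ h₃
  rw [markedCoeff, h₁, h₂, h₃, mul_zero, mul_zero, add_zero, add_zero]
  all_goals rcases hmn with h | h | h | h <;> obtain ⟨rfl, rfl⟩ := Prod.mk.inj h <;> decide

theorem letter_zero_eq_zero (hρ : IsPrimitiveRoot ρ 5) (hy : y ≠ 0)
    (hT : ∀ m, QCommute (ρ ^ m) (T m) y)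
    (hS : shuffleSum y [∑ m ∈ range 5, T m] 4 = 0) : T 0 = 0 := by
  have hcoeff : shuffleCoeff [ρ ^ 0] 4 ≠ 0 := by
    have h5 := five_ne_zero_of_isPrimitiveRoot hρ
    simp only [shuffleCoeff, List.prod_singleton]
    grind
  rw [shuffleSum_singleton_sum hT, sum_eq_single_of_mem 0 (by simp)] at hS
  · simpa only [smul_eq_zero, hcoeff, false_or, mul_eq_zero, pow_eq_zero_iff four_ne_zero, hy,
      or_false] using hS
  · intro m hm hm0
    have hvanish := shuffleCoeff_map_pow_eq_zero hρ (e := [m]) (n := 4) (by simp)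
      (by fin_cases hm <;> first | decide | contradiction) rfl
    simp only [List.map_cons, List.map_nil] at hvanish
    rw [hvanish, zero_smul]

theorem letter_four_eq_zero (hρ : IsPrimitiveRoot ρ 5) (hk : k = 2 ∨ k = 4) (hx : x ≠ 0)
    (hy : y ≠ 0) (hxy : QCommute ρ x y) (hT : ∀ m, QCommute (ρ ^ m) (T m) y)
    (hxT : ∀ m, QCommute (ρ ^ k) x (T m)) (hT₀ : T 0 = 0)
    (hS : markedShuffleSum x y (∑ m ∈ range 5, T m) 3 1 = 0) : T 4 = 0 := by
  have hcoeff : shuffleCoeff [ρ, ρ ^ 4] 3 + ρ ^ k * shuffleCoeff [ρ ^ 4, ρ] 3 ≠ 0 := by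
    have h5 := five_ne_zero_of_isPrimitiveRoot hρ
    have hsum := sum_pow_eq_zero hρ
    simp only [shuffleCoeff, List.prod_cons, List.prod_nil]
    rcases hk with rfl | rfl <;> grind
  rw [markedShuffleSum_one_sum hxy hT hxT, sum_eq_single_of_mem 4 (by simp)] at hS
  · simpa only [smul_eq_zero, hcoeff, false_or, mul_eq_zero, pow_eq_zero_iff three_ne_zero, hx, hy,
      or_false] using hS
  · intro m hm hm4
    obtain rfl | hm0 := eq_or_ne m 0
    · simp [hT₀]
    · have h (e : List ℕ) := shuffleCoeff_map_pow_eq_zero hρ (e := e) (n := 3)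
      have h₁ := h [1, m]
      have h₂ := h [m, 1]
      simp only [List.map_cons, List.map_nil, pow_one] at h₁ h₂
      rw [h₁, h₂, mul_zero, add_zero, zero_smul]
      all_goals fin_cases hm <;> first | decide | contradiction

theorem letter_two_mul_letter_three_eq_zero (hρ : IsPrimitiveRoot ρ 5) (hk : k = 2 ∨ k = 4)
    (hy : y ≠ 0) (hT : ∀ m, QCommute (ρ ^ m) (T m) y) (hT₀ : T 0 = 0) (hT₄ : T 4 = 0)
    (hTT : QCommute ((ρ ^ k) ^ 4) (T 2) (T 3))
    (hS : shuffleSum y [∑ m ∈ range 5, T m, ∑ m ∈ range 5, T m] 3 = 0) : T 2 * T 3 = 0 := by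
  have hcoeff :
      shuffleCoeff [ρ ^ 2, ρ ^ 3] 3 + (ρ ^ k) ^ 4 * shuffleCoeff [ρ ^ 3, ρ ^ 2] 3 ≠ 0 := by
    have h5 := five_ne_zero_of_isPrimitiveRoot hρ
    have hsum := sum_pow_eq_zero hρ
    simp only [shuffleCoeff, List.prod_cons, List.prod_nil]
    rcases hk with rfl | rfl <;> grind
  have hvanish {m n : ℕ} (hm : m ∈ Icc 1 3) (hn : n ∈ Icc 1 3) (hmn : m + n ≠ 5) :
      shuffleCoeff [ρ ^ m, ρ ^ n] 3 = 0 := by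
    refine shuffleCoeff_map_pow_eq_zero hρ (e := [m, n]) (by simp) ?_ rfl
    fin_cases hm <;> fin_cases hn <;> first | decide | contradiction
  rw [QCommute] at hTT
  rw [shuffleSum_pair_sum hT] at hS
  simp only [sum_range_succ, sum_range_zero, hT₀, hT₄, zero_mul, mul_zero, smul_zero, add_zero,
    zero_add, hTT, smul_mul_assoc, smul_smul, hvanish (m := 1) (n := 1), hvanish (m := 1) (n := 2),
    hvanish (m := 1) (n := 3), hvanish (m := 2) (n := 1), hvanish (m := 2) (n := 2),
    hvanish (m := 3) (n := 1), hvanish (m := 3) (n := 3), mem_Icc, le_refl, Nat.reduceLeDiff,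
    and_self, ne_eq, Nat.reduceAdd, Nat.reduceEqDiff, not_false_eq_true, zero_smul] at hS
  rw [← add_smul, mul_comm (shuffleCoeff _ 3)] at hS
  simpa only [smul_eq_zero, hcoeff, false_or, mul_eq_zero (b := y ^ 3),
    pow_eq_zero_iff three_ne_zero, hy, or_false] using hS

theorem letter_relation (hρ : IsPrimitiveRoot ρ 5) {κ : F} (hx : x ≠ 0) (hy : y ≠ 0)
    (hxy : QCommute ρ x y) (hT : ∀ m, QCommute (ρ ^ m) (T m) y)
    (hxT : ∀ m, QCommute κ x (T m)) (hT₀ : T 0 = 0) (hT₄ : T 4 = 0)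
    (hT₂₃ : T 2 * T 3 = 0) (hT₃₂ : T 3 * T 2 = 0)
    (hS : markedShuffleSum x y (∑ m ∈ range 5, T m) 2 2 = 0) :
    markedCoeff ρ κ (ρ ^ 1) (ρ ^ 3) 2 • (T 1 * T 3) +
      markedCoeff ρ κ (ρ ^ 2) (ρ ^ 2) 2 • (T 2 * T 2) +
      markedCoeff ρ κ (ρ ^ 3) (ρ ^ 1) 2 • (T 3 * T 1) = 0 := by
  have hvanish {m n : ℕ} := markedCoeff_map_pow_eq_zero hρ κ (m := m) (n := n)
  rw [markedShuffleSum_two_sum hxy hT hxT] at hS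
  simp only [sum_range_succ, sum_range_zero, hT₀, hT₄, hT₂₃, hT₃₂, zero_mul, mul_zero, smul_zero,
    hvanish (m := 1) (n := 1) (by simp), hvanish (m := 1) (n := 2) (by simp),
    hvanish (m := 2) (n := 1) (by simp), hvanish (m := 3) (n := 3) (by simp), add_zero, zero_add,
    zero_smul] at hS
  refine (mul_eq_zero.mp ((mul_eq_zero (a := x).mp ?_).resolve_left hx)).resolve_right
    (pow_ne_zero 2 hy)
  simpa only [mul_add, add_mul, mul_smul_comm, smul_mul_assoc] using hS

theorem exists_sum_letters_eq (hρ : IsPrimitiveRoot ρ 5) (hk : k = 2 ∨ k = 4)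
    (hT₀ : T 0 = 0) (hT₄ : T 4 = 0) (hT₂₃ : T 2 * T 3 = 0)
    (hTT : QCommute ((ρ ^ k) ^ 3) (T 1) (T 3))
    (hrel : markedCoeff ρ (ρ ^ k) (ρ ^ 1) (ρ ^ 3) 2 • (T 1 * T 3) +
      markedCoeff ρ (ρ ^ k) (ρ ^ 2) (ρ ^ 2) 2 • (T 2 * T 2) +
      markedCoeff ρ (ρ ^ k) (ρ ^ 3) (ρ ^ 1) 2 • (T 3 * T 1) = 0) :
    ∃ m, ∑ m ∈ range 5, T m = T m := by
  have h5 := five_ne_zero_of_isPrimitiveRoot hρ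
  have hsum := sum_pow_eq_zero hρ
  have hcoeff₂ : markedCoeff ρ (ρ ^ k) (ρ ^ 2) (ρ ^ 2) 2 ≠ 0 := by
    simp only [markedCoeff, shuffleCoeff, List.prod_cons, List.prod_nil]
    rcases hk with rfl | rfl <;> grind
  have hcoeff₁₃ : markedCoeff ρ (ρ ^ k) (ρ ^ 1) (ρ ^ 3) 2 +
      markedCoeff ρ (ρ ^ k) (ρ ^ 3) (ρ ^ 1) 2 * (ρ ^ k) ^ 3 ≠ 0 := by
    simp only [markedCoeff, shuffleCoeff, List.prod_cons, List.prod_nil]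
    rcases hk with rfl | rfl <;> grind
  rw [QCommute] at hTT
  rw [hTT, smul_smul, add_right_comm, ← add_smul] at hrel
  have hT₂ : T 2 = 0 := by
    by_contra hT₂
    have hT₃ : T 3 = 0 := (mul_eq_zero.mp hT₂₃).resolve_left hT₂
    simp [hT₃, hcoeff₂, hT₂] at hrel
  have hT₁₃ : T 1 * T 3 = 0 := by
    simpa only [hT₂, mul_zero, smul_zero, add_zero, smul_eq_zero, hcoeff₁₃, false_or] using hrel
  simp only [sum_range_succ, sum_range_zero, hT₀, hT₂, hT₄, zero_add, add_zero]
  rcases mul_eq_zero.mp hT₁₃ with hT₁ | hT₃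
  · exact ⟨3, by rw [hT₁, zero_add]⟩
  · exact ⟨1, by rw [hT₃, add_zero]⟩

end Elimination

section DivisionAlgebra

open Finset

variable {F D : Type*} [Field F] [DivisionRing D] [Algebra F D] {p : ℕ} {ρ ω ζ q r : F}
  {x y t : D}

theorem exists_eq_algebraMap_of_pow_eq_one [NeZero p] (hρ : IsPrimitiveRoot ρ p) {u : D}
    (hu : u ^ p = 1) : ∃ ζ : F, ζ ^ p = 1 ∧ u = algebraMap F D ζ := by
  have hprod := congrArg (Polynomial.aeval u) (Polynomial.X_pow_sub_one_eq_prod (NeZero.pos p) hρ)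
  rw [← prod_map_toList, map_list_prod, map_sub, map_pow, Polynomial.aeval_X, map_one, hu,
    sub_self, eq_comm, List.prod_eq_zero_iff] at hprod
  simp only [List.map_map, List.mem_map, mem_toList] at hprod
  obtain ⟨ζ, hζ, hzero⟩ := hprod
  exact ⟨ζ, (Polynomial.mem_nthRootsFinset (NeZero.pos p) 1).mp hζ,
    by simpa [sub_eq_zero] using hzero⟩

theorem QCommute.pow_mul_pow_right (hxy : QCommute q x y) (i j : ℕ) :
    QCommute (q ^ j) x (x ^ i * y ^ j) := by
  simpa using (QCommute.of_commute ((Commute.refl x).pow_right i)).mul_right (hxy.pow_right j)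

theorem QCommute.pow_mul_pow_left (hxy : QCommute q x y) (i j : ℕ) :
    QCommute (q ^ i) (x ^ i * y ^ j) y := by
  simpa using (hxy.pow_left i).mul_left (.of_commute ((Commute.refl y).pow_left j))

theorem linearIndependent_pow_mul_pow (hρ : IsPrimitiveRoot ρ p) (hx : x ≠ 0) (hy : y ≠ 0)
    (hxy : QCommute ρ x y) :
    LinearIndependent F fun i : Fin p × Fin p => x ^ (i.1 : ℕ) * y ^ (i.2 : ℕ) := by
  refine Fintype.linearIndependent_iff.mpr fun c hc ⟨i, j⟩ => ?_
  have hinj : Set.InjOn (fun i : Fin p => ρ ^ (i : ℕ)) (univ : Finset (Fin p)) :=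
    fun i _ j _ h => Fin.ext (hρ.pow_inj i.2 j.2 h)
  have hrow (j : Fin p) : ∑ i : Fin p, c (i, j) • (x ^ (i : ℕ) * y ^ (j : ℕ)) = 0 := by
    rw [Fintype.sum_prod_type_right] at hc
    refine QCommute.eq_zero_of_sum_eq_zero
      (b := fun j : Fin p => ∑ i : Fin p, c (i, j) • (x ^ (i : ℕ) * y ^ (j : ℕ))) hinj hx.isUnit
      (fun j _ => .sum_right fun i _ => ?_) hc (mem_univ j)
    exact (hxy.pow_mul_pow_right i j).smul_right _
  have hterm : c (i, j) • (x ^ (i : ℕ) * y ^ (j : ℕ)) = 0 := by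
    refine QCommute.eq_zero_of_sum_eq_zero
      (q := fun i : Fin p => (ρ ^ (i : ℕ))⁻¹) (fun i hi j hj h => hinj hi hj (inv_injective h))
      hy.isUnit (fun i _ => ?_) (hrow j) (mem_univ i)
    exact ((hxy.pow_mul_pow_left i j).symm (pow_ne_zero _ (hρ.ne_zero i.pos.ne'))).smul_right _
  exact (smul_eq_zero.mp hterm).resolve_right
    (mul_ne_zero (pow_ne_zero _ hx) (pow_ne_zero _ hy))

theorem span_range_pow_mul_pow [NeZero p] (hρ : IsPrimitiveRoot ρ p)
    (hD : Module.finrank F D = p ^ 2) (hx : x ≠ 0) (hy : y ≠ 0) (hxy : QCommute ρ x y) :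
    Submodule.span F (Set.range fun i : Fin p × Fin p => x ^ (i.1 : ℕ) * y ^ (i.2 : ℕ)) = ⊤ :=
  (linearIndependent_pow_mul_pow hρ hx hy hxy).span_eq_top_of_card_eq_finrank
    (by rw [Fintype.card_prod, Fintype.card_fin, hD, sq])

theorem mem_center_of_commute [NeZero p] (hρ : IsPrimitiveRoot ρ p)
    (hD : Module.finrank F D = p ^ 2) (hx : x ≠ 0) (hy : y ≠ 0) (hxy : QCommute ρ x y) {a : D}
    (hax : Commute a x) (hay : Commute a y) : a ∈ Subalgebra.center F D := by
  refine Subalgebra.mem_center_iff.mpr fun b => ?_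
  have hb : b ∈ Submodule.span F
      (Set.range fun i : Fin p × Fin p => x ^ (i.1 : ℕ) * y ^ (i.2 : ℕ)) := by
    rw [span_range_pow_mul_pow hρ hD hx hy hxy]
    trivial
  induction hb using Submodule.span_induction with
  | mem b hb =>
    obtain ⟨i, rfl⟩ := hb
    exact ((hax.pow_right _).mul_right (hay.pow_right _)).symm
  | zero => rw [zero_mul, mul_zero]
  | add b c _ _ hb hc => rw [add_mul, mul_add, hb, hc]
  | smul s b _ hb => rw [smul_mul_assoc, mul_smul_comm, hb]

theorem isVertex_of_qCommute [Fact p.Prime] (hω : ω ^ p = 1) (hne : ω ≠ 1)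
    (hD : Module.finrank F D = p ^ 2) (hx : x ≠ 0) (hy : y ≠ 0) (hxy : QCommute ω x y) :
    IsVertex F p y := by
  have hpow := hxy.pow_right p
  rw [hω] at hpow
  exact isVertex_of_pow_mem_center hy.isUnit
    (mem_center_of_commute (isPrimitiveRoot_of_pow_eq_one hω hne) hD hx hy hxy hpow.commute.symm
      ((Commute.refl y).pow_left p)) (hxy.not_mem_center hne (mul_ne_zero hx hy))

theorem exists_eq_sum_smul_pow_mul_pow [NeZero p] (hρ : IsPrimitiveRoot ρ p)
    (hD : Module.finrank F D = p ^ 2) (hx : x ≠ 0) (hy : y ≠ 0) (hxy : QCommute ρ x y) {k : ℕ}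
    (hk : k < p) (hxt : QCommute (ρ ^ k) x t) :
    ∃ c : ℕ → F, t = ∑ i ∈ range p, c i • (x ^ i * y ^ k) := by
  have htop : t ∈ Submodule.span F
      (Set.range fun i : Fin p × Fin p => x ^ (i.1 : ℕ) * y ^ (i.2 : ℕ)) := by
    rw [span_range_pow_mul_pow hρ hD hx hy hxy]
    trivial
  obtain ⟨c, hc⟩ := (Submodule.mem_span_range_iff_exists_fun F).mp htop
  let b (j : Fin p) : D := ∑ i, c (i, j) • (x ^ (i : ℕ) * y ^ (j : ℕ))
  have hb : ∑ j, (b j - if j = ⟨k, hk⟩ then t else 0) = 0 := by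
    rw [sum_sub_distrib, sum_ite_eq' univ, if_pos (mem_univ _), sub_eq_zero, ← hc,
      Fintype.sum_prod_type_right]
  have hzero := QCommute.eq_zero_of_sum_eq_zero (q := fun j : Fin p => ρ ^ (j : ℕ))
    (fun i _ j _ h => Fin.ext (hρ.pow_inj i.2 j.2 h)) hx.isUnit (fun j _ => ?_) hb
    (mem_univ ⟨k, hk⟩)
  · rw [if_pos rfl, sub_eq_zero] at hzero
    refine ⟨fun i => c (Fin.ofNat p i, ⟨k, hk⟩), ?_⟩
    rw [← hzero, ← Fin.sum_univ_eq_sum_range fun i => c (Fin.ofNat p i, ⟨k, hk⟩) • (x ^ i * y ^ k)]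
    simp [b]
  · have hbj : QCommute (ρ ^ (j : ℕ)) x (b j) :=
      .sum_right fun i _ => (hxy.pow_mul_pow_right i j).smul_right _
    split_ifs with hj
    · subst hj
      simpa [sub_eq_add_neg] using hbj.add_right (hxt.smul_right (-1))
    · rwa [sub_zero]

theorem commute_of_commute [NeZero p] (hρ : IsPrimitiveRoot ρ p)
    (hD : Module.finrank F D = p ^ 2) (hx : x ≠ 0) (hy : y ≠ 0) (hxy : QCommute ρ x y) {a b : D}
    (ha : Commute x a) (hb : Commute x b) : Commute a b := by
  obtain ⟨c, rfl⟩ := exists_eq_sum_smul_pow_mul_pow hρ hD hx hy hxy (NeZero.pos p)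
    (by simpa using QCommute.of_commute (R := F) ha)
  refine Commute.sum_left _ _ _ fun i _ => .smul_left ?_ _
  simpa using hb.pow_left i

/-- The quotient of the two summands of `z = y + t` links `x` with `z`. -/
theorem reflTransGen_add [Fact p.Prime] (hD : Module.finrank F D = p ^ 2) (hx : IsVertex F p x)
    (hz : IsVertex F p (y + t)) (hy : y ≠ 0) (ht : t ≠ 0) (hq : q ^ p = 1) (hr : r ^ p = 1)
    (hqr : q ≠ r) (hxy : QCommute q x y) (hxt : QCommute r x t) (hζ : ζ ^ p = 1)
    (hty : QCommute ζ t y) : Relation.ReflTransGen (RostAdj F p) x (y + t) := by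
  have hq0 : q ≠ 0 := (IsUnit.of_pow_eq_one hq (NeZero.ne p)).ne_zero
  have hζ0 : ζ ≠ 0 := (IsUnit.of_pow_eq_one hζ (NeZero.ne p)).ne_zero
  have hxw : QCommute (q⁻¹ * r) x (y⁻¹ * t) := (hxy.inv_right hy hq0).mul_right hxt
  have hroot : (q⁻¹ * r) ^ p = 1 := by rw [mul_pow, inv_pow, hq, hr, inv_one, one_mul]
  have hne : q⁻¹ * r ≠ 1 := by rwa [ne_eq, inv_mul_eq_one₀ hq0]
  have hw : IsVertex F p (y⁻¹ * t) :=
    isVertex_of_qCommute hroot hne hD hx.2.ne_zero (mul_ne_zero (inv_ne_zero hy) ht) hxw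
  have hyw : QCommute ζ⁻¹ y (y⁻¹ * t) := by
    simpa using (QCommute.of_commute (Commute.refl y).inv_right₀).mul_right (hty.symm hζ0)
  have htw : QCommute ζ⁻¹ t (y⁻¹ * t) := by
    simpa using (hty.inv_right hy hζ0).mul_right (.of_commute (.refl t))
  have hzw : RostAdj F p (y + t) (y⁻¹ * t) :=
    ⟨hz, hw, ζ⁻¹, by rw [inv_pow, hζ, inv_one], hyw.add_left htw⟩
  exact .tail (.single ⟨hx, hw, _, hroot, hxw⟩) hzw.symm

theorem mul_shuffleSum_singleton_add {A : Type*} [Ring A] (y a : A) (n : ℕ) :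
    y * shuffleSum y [a] n + a * y ^ (n + 1) = shuffleSum y [a] n * y + y ^ (n + 1) * a := by
  induction n with
  | zero => simp [shuffleSum, add_comm]
  | succ n ih =>
    simp only [shuffleSum] at ih ⊢
    nth_rw 1 [ih]
    rw [mul_add, add_mul, ← mul_assoc, ← mul_assoc, ← pow_succ', mul_assoc a, ← pow_succ,
      add_right_comm]

theorem exists_qCommute_of_commute [Fact p.Prime] (hω : IsPrimitiveRoot ω p)
    (hD : Module.finrank F D = p ^ 2) (hx : x ≠ 0) (hy : y ≠ 0) (ht : t ≠ 0)
    (hxy : QCommute ω x y) (hxt : Commute x t) (hz : (y + t) ^ p ∈ Subalgebra.center F D) :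
    ∃ ζ : F, ζ ^ p = 1 ∧ QCommute ζ t y := by
  have hp := Fact.out (p := p.Prime)
  have hS : shuffleSum t [y] (p - 1) = 0 :=
    shuffleSum_replicate_eq_zero (b := 1) hx.isUnit (one_pow p) hω.pow_eq_one
      (hω.ne_one hp.one_lt).symm (.of_commute hxt) hxy (by rwa [add_comm])
      (Nat.sub_ne_zero_of_lt hp.one_lt) one_ne_zero (Nat.sub_add_cancel hp.one_le)
  have hyt : y * t ^ p = t ^ p * y := by
    simpa [hS, Nat.sub_add_cancel hp.one_le] using mul_shuffleSum_singleton_add t y (p - 1)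
  have hxu : Commute x (y * t * y⁻¹) := by
    refine QCommute.commute (R := F) ?_
    simpa [hω.ne_zero hp.ne_zero] using
      (hxy.mul_right (.of_commute hxt)).mul_right (hxy.inv_right hy (hω.ne_zero hp.ne_zero))
  have hcomm : Commute t⁻¹ (y * t * y⁻¹) :=
    (commute_of_commute hω hD hx hy hxy hxt hxu).inv_left₀
  have hconj : (y * t * y⁻¹) ^ p = y * t ^ p * y⁻¹ := Units.conj_pow (Units.mk0 y hy) t p
  have hroot : (t⁻¹ * (y * t * y⁻¹)) ^ p = 1 := by
    rw [hcomm.mul_pow, hconj, hyt, mul_inv_cancel_right₀ hy, inv_pow,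
      inv_mul_cancel₀ (pow_ne_zero p ht)]
  obtain ⟨ζ, hζ, hscalar⟩ := exists_eq_algebraMap_of_pow_eq_one hω hroot
  refine ⟨ζ, hζ, ?_⟩
  rw [inv_mul_eq_iff_eq_mul₀ ht, mul_inv_eq_iff_eq_mul₀ hy] at hscalar
  rw [QCommute, hscalar, ← Algebra.commutes, mul_assoc, Algebra.smul_def]

end DivisionAlgebra

section WeightTwo

open Finset

variable {F D : Type*} [Field F] [DivisionRing D] [Algebra F D] {p : ℕ} {ρ q r : F} {x y z t : D}

theorem QCommute.pow_mul_pow_pow_mul_pow (hρ : ρ ^ p = 1) (hxy : QCommute ρ x y) (k : ℕ)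
    {m n e : ℕ} (he : n + e ≡ m [MOD p]) :
    QCommute ((ρ ^ k) ^ e) (x ^ m * y ^ k) (x ^ n * y ^ k) := by
  have hroot : (ρ ^ k) ^ m = (ρ ^ k) ^ n * (ρ ^ k) ^ e := by
    rw [← pow_add]
    exact (pow_eq_pow_of_modEq he (by rw [pow_right_comm, hρ, one_pow])).symm
  have hswap (i j : ℕ) : x ^ i * y ^ k * (x ^ j * y ^ k) =
      (ρ ^ k) ^ j • (x ^ (i + j) * (y ^ k * y ^ k)) := by
    have hcomm := (hxy.pow_right k).pow_left j
    rw [QCommute] at hcomm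
    rw [mul_assoc, ← mul_assoc (y ^ k), hcomm, smul_mul_assoc, mul_smul_comm, mul_assoc,
      ← mul_assoc (x ^ i), ← pow_add]
  rw [QCommute, hswap, hswap, smul_smul, hroot, add_comm n, mul_comm ((ρ ^ k) ^ n)]

theorem exists_qCommute_of_qCommute_pow (hρ : IsPrimitiveRoot ρ 5)
    (hD : Module.finrank F D = 5 ^ 2) (hx : x ≠ 0) (hy : y ≠ 0) (hxy : QCommute ρ x y) {k : ℕ}
    (hk : k = 2 ∨ k = 4) (hxt : QCommute (ρ ^ k) x t)
    (hz : (y + t) ^ 5 ∈ Subalgebra.center F D)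
    (hsum : ∑ j ∈ range 5, (y + t) ^ j * x * (y + t) ^ (4 - j) = 0) :
    ∃ ζ : F, ζ ^ 5 = 1 ∧ QCommute ζ t y := by
  have : Fact (Nat.Prime 5) := ⟨Nat.prime_five⟩
  have hk5 : k < 5 := by lia
  have hroot : (ρ ^ k) ^ 5 = 1 := by rw [pow_right_comm, hρ.pow_eq_one, one_pow]
  have hne : ρ ≠ ρ ^ k := fun h => by
    have := hρ.pow_inj (i := 1) (by norm_num) hk5 (by rwa [pow_one])
    lia
  have hS {a b : ℕ} := shuffleSum_replicate_eq_zero (a := a) (b := b) hx.isUnit hρ.pow_eq_one hroot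
    hne hxy hxt hz
  have hM {b : ℕ} := markedShuffleSum_eq_zero (b := b) hx.isUnit hρ.pow_eq_one hroot hne hxy hxt
    hsum
  obtain ⟨c, rfl⟩ := exists_eq_sum_smul_pow_mul_pow hρ hD hx hy hxy hk5 hxt
  let T (m : ℕ) : D := c m • (x ^ m * y ^ k)
  have hT (m : ℕ) : QCommute (ρ ^ m) (T m) y := (hxy.pow_mul_pow_left m k).smul_left _
  have hxT (m : ℕ) : QCommute (ρ ^ k) x (T m) := (hxy.pow_mul_pow_right m k).smul_right _
  have hTT {m n e : ℕ} (he : n + e ≡ m [MOD 5]) : QCommute ((ρ ^ k) ^ e) (T m) (T n) :=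
    ((hxy.pow_mul_pow_pow_mul_pow hρ.pow_eq_one k he).smul_left _).smul_right _
  have hT₀ : T 0 = 0 :=
    letter_zero_eq_zero hρ hy hT (hS (a := 4) (b := 1) four_ne_zero one_ne_zero rfl)
  have hT₄ : T 4 = 0 :=
    letter_four_eq_zero hρ hk hx hy hxy hT hxT hT₀ (hM (b := 1) (by norm_num))
  have hT₂₃ : T 2 * T 3 = 0 := letter_two_mul_letter_three_eq_zero hρ hk hy hT hT₀ hT₄
    (hTT (by decide)) (hS (a := 3) (b := 2) three_ne_zero two_ne_zero rfl)
  have hT₃₂ : T 3 * T 2 = 0 := mul_eq_zero.mpr (mul_eq_zero.mp hT₂₃).symm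
  obtain ⟨m, hm⟩ := exists_sum_letters_eq hρ hk hT₀ hT₄ hT₂₃ (hTT (by decide))
    (letter_relation hρ hx hy hxy hT hxT hT₀ hT₄ hT₂₃ hT₃₂ (hM (b := 2) (by norm_num)))
  refine ⟨ρ ^ m, by rw [pow_right_comm, hρ.pow_eq_one, one_pow], ?_⟩
  exact hm ▸ hT m

/-- If `r` is the cube of `q`, then `q` is the square of `r`, so the roles of `y` and `t` can be
exchanged. -/
theorem exists_qCommute_of_qCommute (hq : q ^ 5 = 1) (hr : r ^ 5 = 1) (hq1 : q ≠ 1) (hr1 : r ≠ 1)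
    (hqr : q ≠ r) (hD : Module.finrank F D = 5 ^ 2) (hx : x ≠ 0) (hy : y ≠ 0) (ht : t ≠ 0)
    (hxy : QCommute q x y) (hxt : QCommute r x t) (hz : (y + t) ^ 5 ∈ Subalgebra.center F D)
    (hsum : ∑ j ∈ range 5, (y + t) ^ j * x * (y + t) ^ (4 - j) = 0) :
    ∃ ζ : F, ζ ^ 5 = 1 ∧ QCommute ζ t y := by
  have : Fact (Nat.Prime 5) := ⟨Nat.prime_five⟩
  have hqprim := isPrimitiveRoot_of_pow_eq_one hq hq1
  obtain ⟨k, hk, rfl⟩ := hqprim.eq_pow_of_pow_eq_one hr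
  have hk0 : k ≠ 0 := by rintro rfl; simp at hr1
  have hk1 : k ≠ 1 := by rintro rfl; simp at hqr
  by_cases hk3 : k = 3
  · subst hk3
    have hsquare : q = (q ^ 3) ^ 2 := by
      rw [← pow_mul, show 3 * 2 = 5 + 1 by rfl, pow_succ, hq, one_mul]
    rw [add_comm y] at hz hsum
    obtain ⟨ζ, hζ, hyt⟩ := exists_qCommute_of_qCommute_pow
      (isPrimitiveRoot_of_pow_eq_one hr hr1) hD hx ht hxt (.inl rfl) (hsquare ▸ hxy) hz hsum
    exact ⟨ζ⁻¹, by rw [inv_pow, hζ, inv_one],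
      hyt.symm (IsUnit.of_pow_eq_one hζ (by norm_num)).ne_zero⟩
  · exact exists_qCommute_of_qCommute_pow hqprim hD hx hy hxy (by lia) hxt hz hsum

theorem reflTransGen_add_of_commute [Fact p.Prime] (hD : Module.finrank F D = p ^ 2)
    (hx : IsVertex F p x) (hz : IsVertex F p (y + t)) (hy : y ≠ 0) (ht : t ≠ 0) (hq : q ^ p = 1)
    (hq1 : q ≠ 1) (hxy : QCommute q x y) (hxt : Commute x t) :
    Relation.ReflTransGen (RostAdj F p) x (y + t) := by
  obtain ⟨ζ, hζ, hty⟩ := exists_qCommute_of_commute (isPrimitiveRoot_of_pow_eq_one hq hq1) hD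
    hx.2.ne_zero hy ht hxy hxt hz.1.2.1
  exact reflTransGen_add hD hx hz hy ht hq (one_pow p) hq1 hxy (.of_commute hxt) hζ hty

theorem reflTransGen_of_zero_mem_label [Fact p.Prime] (hρ : IsPrimitiveRoot ρ p)
    (hD : Module.finrank F D = p ^ 2) (hx : IsVertex F p x) (hz : IsVertex F p z)
    (hw : weight p ρ x z = 2) (h0 : 0 ∈ label p ρ x z) :
    Relation.ReflTransGen (RostAdj F p) x z := by
  obtain ⟨q, r, y, t, hq, hr, hqr, hlabel, rfl, hy, ht, hxy, hxt⟩ :=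
    exists_eq_add_of_weight_eq_two hρ hx hw
  rcases hlabel.mp h0 with rfl | rfl
  · rw [add_comm y] at hz ⊢
    exact reflTransGen_add_of_commute hD hx hz ht hy hr hqr.symm hxt hxy.commute
  · exact reflTransGen_add_of_commute hD hx hz hy ht hq hqr hxy hxt.commute

theorem reflTransGen_of_zero_notMem_label (hρ : IsPrimitiveRoot ρ 5)
    (hD : Module.finrank F D = 5 ^ 2) (hx : IsVertex F 5 x) (hz : IsVertex F 5 z)
    (hw : weight 5 ρ x z = 2) (hxz : 0 ∉ label 5 ρ x z) (hzx : 0 ∉ label 5 ρ z x) :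
    Relation.ReflTransGen (RostAdj F 5) x z := by
  have : Fact (Nat.Prime 5) := ⟨Nat.prime_five⟩
  obtain ⟨q, r, y, t, hq, hr, hqr, hlabel, rfl, hy, ht, hxy, hxt⟩ :=
    exists_eq_add_of_weight_eq_two hρ hx hw
  obtain ⟨hq1, hr1⟩ := not_or.mp (hlabel.not.mp hxz)
  obtain ⟨ζ, hζ, hty⟩ := exists_qCommute_of_qCommute hq hr hq1 hr1 hqr hD hx.2.ne_zero hy ht hxy
    hxt hz.1.2.1 (sum_pow_mul_mul_pow_eq_zero hρ hz hzx)
  exact reflTransGen_add hD hx hz hy ht hq hr hqr hxy hxt hζ hty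

theorem reflTransGen_of_isUnit_or_eq_zero {A : Type*} [Ring A] [Nontrivial A] [Algebra F A]
    (h : ∀ a : A, IsUnit a ∨ a = 0) (hρ : IsPrimitiveRoot ρ 5) (hA : Module.finrank F A = 5 ^ 2)
    {x z : A} (hx : IsVertex F 5 x) (hz : IsVertex F 5 z) (hw : weight 5 ρ x z = 2)
    (h0 : 0 ∈ label 5 ρ x z ∨ 0 ∉ label 5 ρ z x) : Relation.ReflTransGen (RostAdj F 5) x z := by
  have : Fact (Nat.Prime 5) := ⟨Nat.prime_five⟩
  let : DivisionRing A := DivisionRing.ofIsUnitOrEqZero h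
  by_cases hxz : 0 ∈ label 5 ρ x z
  · exact reflTransGen_of_zero_mem_label hρ hA hx hz hw hxz
  · exact reflTransGen_of_zero_notMem_label hρ hA hx hz hw hxz (h0.resolve_left hxz)

end WeightTwo

end RostChains

theorem mainTheorem8_general {F : Type*} [Field F] {ρ : F} (hρ : IsPrimitiveRoot ρ 5)
    {A : Type*} [Ring A] [Algebra F A] [IsSimpleRing A] (hA : Module.finrank F A = 5 ^ 2)
    {x z : A} (hx : RostChains.IsVertex F 5 x) (hz : RostChains.IsVertex F 5 z)
    (hw : RostChains.weight 5 ρ x z = 2)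
    (h0 : 0 ∈ RostChains.label 5 ρ x z ∨ 0 ∉ RostChains.label 5 ρ z x) :
    RostChains.RostConnected 5 ρ x z := by
  have : Fact (Nat.Prime 5) := ⟨Nat.prime_five⟩
  refine RostChains.rostConnected_of_reflTransGen hρ hx ?_
  obtain hunit | ⟨⟨e⟩⟩ :=
    RostChains.isUnit_or_eq_zero_or_nonempty_algEquiv_end Nat.prime_five hA
  · exact RostChains.reflTransGen_of_isUnit_or_eq_zero hunit hρ hA hx hz hw h0
  · exact RostChains.reflTransGen_of_map e (RostChains.reflTransGen_end (by norm_num) hρ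
      (Module.finrank_fin_fun F) (hx.map e) (hz.map e))

theorem mainTheorem8 {F : Type*} [Field F] {ρ : F} (hρ : IsPrimitiveRoot ρ 5)
    {A : Type*} [Ring A] [Algebra F A] (hA : RostChains.IsCyclicAlgebra 5 ρ A)
    (x z : A) (hx : RostChains.IsVertex F 5 x) (hz : RostChains.IsVertex F 5 z)
    (hw : RostChains.weight 5 ρ x z = 2) (h0 : (0 : ZMod 5) ∉ RostChains.label 5 ρ z x) :
    RostChains.RostConnected 5 ρ x z :=
  have := hA.2.1
  mainTheorem8_general hρ hA.2.2.1 hx hz hw (.inr h0)
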